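/- Let $n\ge 2$ and let $f:(0,\infty)\to(0,\infty)$ be a smooth function such that, for all $K>0$, (i) $f'(K)>0$; (ii) $\alpha_1\le \frac{nKf'(K)-f(K)}{f(K)}\le \alpha_2$ for some constants $0<\alpha_1<\alpha_2\le n-1$; (iii) $0<\frac{Kf''(K)}{f'(K)}+1-\frac1n\le\beta$ for some constant $\beta>0$; (iv) $K/f(K)^{\gamma}\ge\hat\gamma$ for all sufficiently large $K$, for some constants $\gamma,\hat\gamma>0$; (v) $f(K)$ is convex as a function of the principal radii, i.e. $(r_1,\dots,r_n)\mapsto f\big(1/(r_1\cdots r_n)\big)$ is convex on $(0,\infty)^n$. Let $M_0\subset\mathbb R^{n+1}$ be a smooth closed strictly convex hypersurface, parametrized by $F_0:S^n\to M_0$. Let $\vartheta>0$, $0<T\le\infty$, and let $M_t$, $0\le t<T$, be a smooth solution, consisting of smooth closed strictly convex hypersurfaces, of the flow $$\frac{\partial F}{\partial t}=-f(K)\,\nu ,\qquad F(\cdot,0)=\vartheta F_0,$$ where $\nu$ is the unit outer normal and $K$ the Gauss curvature of $M_t$. Parametrize each $M_t$ (and $M_0$) by the inverse of its Gauss map, so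 that $F(x,t)$ is the point of $M_t$ with outer unit normal $x\in S^n$ (tangential components of $\partial F/\partial t$ are then disregarded), and let $u(x,t)=\langle F(x,t),x\rangle$ be the support function; the flow then reads $\partial_t u=-f(K)$ on $S^n\times[0,T)$. Let $w_{ij}=\nabla_{ij}u+u\,\delta_{ij}$ in an orthonormal frame of $S^n$, where $\nabla_{ij}u$ is the covariant Hessian on the round sphere; its eigenvalues are the principal radii of curvature of $M_t$. Let $R(t)$ be the outer radius of $M_t$, i.e. the infimum of the radii of the balls containing $M_t$, and let $R_0=\sup\{R(t):t\in(0,T)\}$. Then $R_0<\infty$, and there is a constant $C>0$, depending only on $n$, $f$ and $F_0$ (in particular not on $t$, $x$, $\vartheta$ or $T$), such that every eigenvalue $\chi$ of $\{w_{ij}(x,t)\}$ satisfies $$\chi\le C\,(1+R_0)\qquad\text{for all } x\in S^n,\ t\in[0,T).$$ -/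

import Mathlib

open scoped ContDiff Manifold RealInnerProductSpace

noncomputable section

namespace GaussFlow

/-- The Euclidean space `ℝⁿ⁺¹`. -/
abbrev Amb (n : ℕ) : Type := EuclideanSpace ℝ (Fin (n + 1))

instance factFinrankAmb (n : ℕ) : Fact (Module.finrank ℝ (Amb n) = n + 1) :=
  ⟨by simp⟩

/-- The unit sphere `Sⁿ ⊂ ℝⁿ⁺¹`. -/
abbrev Sph (n : ℕ) : Type := Metric.sphere (0 : Amb n) 1

/-- The tangent space `T_x Sⁿ = x^⊥`, with the standard metric of the sphere. -/
abbrev Tan {n : ℕ} (x : Sph n) : Submodule ℝ (Amb n) :=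
  (Submodule.span ℝ {(x : Amb n)})ᗮ

/-- The degree-zero homogeneous extension `y ↦ G (y / ‖y‖)` of a function on `Sⁿ` to `ℝⁿ⁺¹`
(with the irrelevant value `0` at the origin). -/
def radialExt {n : ℕ} {V : Type*} [Zero V] (G : Sph n → V) (y : Amb n) : V :=
  open Classical in
  if h : y = 0 then 0
  else G ⟨‖y‖⁻¹ • y, by simp [norm_smul, inv_mul_cancel₀ (norm_ne_zero_iff.mpr h)]⟩

/-- The differential of `G : Sⁿ → ℝⁿ⁺¹` at `x`, applied to a tangent vector `a ∈ T_x Sⁿ`. -/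
def tangentDeriv {n : ℕ} (G : Sph n → Amb n) (x : Sph n) (a : Tan x) : Amb n :=
  fderiv ℝ (radialExt G) (x : Amb n) (a : Amb n)

/-- The covariant Hessian `∇²u (a, b)` at `x` of a function `u` on the round sphere `Sⁿ`.
The degree-zero extension of `u` is constant along rays, hence its Euclidean Hessian on `x^⊥` is
the Levi-Civita Hessian of the sphere: `∇²u (a, a)` is the second derivative at `s = 0` of `u`
along the great circle `s ↦ cos s • x + sin s • a` if `‖a‖ = 1`. -/
def sphereHess {n : ℕ} (u : Sph n → ℝ) (x : Sph n) (a b : Tan x) : ℝ :=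
  fderiv ℝ (fderiv ℝ (radialExt u)) (x : Amb n) (a : Amb n) (b : Amb n)

/-- The matrix `w_ij = ∇_ij u + u δ_ij` in an orthonormal frame `e` of `T_x Sⁿ`. -/
def radiiMatrix {n : ℕ} (u : Sph n → ℝ) (x : Sph n) (e : OrthonormalBasis (Fin n) ℝ (Tan x)) :
    Matrix (Fin n) (Fin n) ℝ :=
  Matrix.of fun i j => sphereHess u x (e i) (e j) + u x * (if i = j then 1 else 0)

/-- The second fundamental form at `F x`, with respect to the normal `x`, of a hypersurface
`F : Sⁿ → ℝⁿ⁺¹` parametrized by the inverse of its Gauss map. As the normal field is `ν (x) = x`,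
`h (a, b) = -⟨∂_a ∂_b F, ν⟩ = ⟨∂_a F, ∂_b ν⟩ = ⟨∂_a F, b⟩`. -/
def secondForm {n : ℕ} (F : Sph n → Amb n) (x : Sph n) (a b : Tan x) : ℝ :=
  ⟪tangentDeriv F x a, (b : Amb n)⟫

/-- The induced metric `g (a, b) = ⟨∂_a F, ∂_b F⟩`. -/
def inducedMetric {n : ℕ} (F : Sph n → Amb n) (x : Sph n) (a b : Tan x) : ℝ :=
  ⟪tangentDeriv F x a, tangentDeriv F x b⟫

/-- The Gauss curvature `K = det h_ij / det g_ij` (the quotient does not depend on the basis). -/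
def gaussCurvature {n : ℕ} (F : Sph n → Amb n) (x : Sph n) : ℝ :=
  (Matrix.of fun i j => secondForm F x (stdOrthonormalBasis ℝ (Tan x) i)
      (stdOrthonormalBasis ℝ (Tan x) j)).det /
    (Matrix.of fun i j => inducedMetric F x (stdOrthonormalBasis ℝ (Tan x) i)
      (stdOrthonormalBasis ℝ (Tan x) j)).det

/-- `F : Sⁿ → ℝⁿ⁺¹` is the parametrization by the inverse of the Gauss map of a smooth closed
strictly convex hypersurface: the unit vector `x` is normal to the hypersurface at `F x`, and the
second fundamental form with respect to it is positive definite (so that `F` is an immersion and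
`x` is the outer normal). -/
structure IsStrictlyConvex {n : ℕ} (F : Sph n → Amb n) : Prop where
  smooth : ContMDiff (𝓡 n) 𝓘(ℝ, Amb n) ∞ F
  normal : ∀ (x : Sph n) (a : Tan x), ⟪tangentDeriv F x a, (x : Amb n)⟫ = 0
  convex : ∀ (x : Sph n) (a : Tan x), a ≠ 0 → 0 < secondForm F x a a

/-- The support function `u (x) = ⟨F x, x⟩`. -/
def supportFn {n : ℕ} (F : Sph n → Amb n) (x : Sph n) : ℝ :=
  ⟪F x, (x : Amb n)⟫

/-- The outer radius of a bounded set: the infimum of the radii of the balls that contain it. -/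
def outerRadius {n : ℕ} (M : Set (Amb n)) : ℝ :=
  sInf {r : ℝ | 0 ≤ r ∧ ∃ z : Amb n, M ⊆ Metric.closedBall z r}

/-- The conditions on the speed function `f : (0, ∞) → (0, ∞)`. -/
structure SpeedCondition (n : ℕ) (f : ℝ → ℝ) : Prop where
  smooth : ContDiffOn ℝ ∞ f (Set.Ioi 0)
  pos : ∀ K : ℝ, 0 < K → 0 < f K
  deriv_pos : ∀ K : ℝ, 0 < K → 0 < deriv f K
  ratio : ∃ α₁ α₂ : ℝ, 0 < α₁ ∧ α₁ < α₂ ∧ α₂ ≤ (n : ℝ) - 1 ∧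
    ∀ K : ℝ, 0 < K →
      α₁ ≤ ((n : ℝ) * K * deriv f K - f K) / f K ∧
      ((n : ℝ) * K * deriv f K - f K) / f K ≤ α₂
  second : ∃ β : ℝ, 0 < β ∧ ∀ K : ℝ, 0 < K →
      0 < K * deriv (deriv f) K / deriv f K + 1 - 1 / (n : ℝ) ∧
      K * deriv (deriv f) K / deriv f K + 1 - 1 / (n : ℝ) ≤ β
  growth : ∃ γ γ' : ℝ, 0 < γ ∧ 0 < γ' ∧ ∃ K₀ : ℝ, 0 < K₀ ∧ ∀ K : ℝ, K₀ ≤ K →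
      γ' ≤ K / f K ^ γ
  /-- `f (K)` is a convex function of the principal radii `r₁, …, rₙ > 0`, `K = 1 / (r₁ ⋯ rₙ)`. -/
  convex : ConvexOn ℝ {r : Fin n → ℝ | ∀ i, 0 < r i} fun r => f (1 / ∏ i, r i)

/-- The time interval `[0, T)`, where `T ≤ ∞`. -/
def timeInterval (T : EReal) : Set ℝ := {t : ℝ | 0 ≤ t ∧ (t : EReal) < T}

/-- `F` is a smooth solution on `Sⁿ × [0, T)` of the flow with normal speed `-f (K)` that starts
from `ϑ F₀`, every `M_t = F (Sⁿ, t)` being strictly convex and parametrized by the inverse of its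
Gauss map. In this parametrization the outer normal at `F (x, t)` is `x`, so the flow
(`⟨∂F/∂t, ν⟩ = -f (K)`, the tangential part of `∂F/∂t` being a reparametrization of `M_t`) reads
`∂u/∂t = -f (K)` for `u (x, t) = ⟨F (x, t), x⟩`. -/
structure IsFlow {n : ℕ} (f : ℝ → ℝ) (ϑ : ℝ) (F₀ : Sph n → Amb n) (T : EReal)
    (F : ℝ → Sph n → Amb n) : Prop where
  time_pos : 0 < T
  smooth : ContMDiffOn (𝓘(ℝ, ℝ).prod (𝓡 n)) 𝓘(ℝ, Amb n) ∞
    (fun p : ℝ × Sph n => F p.1 p.2) (timeInterval T ×ˢ Set.univ)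
  strictlyConvex : ∀ t ∈ timeInterval T, IsStrictlyConvex (F t)
  initial : ∀ x : Sph n, F 0 x = ϑ • F₀ x
  evolution : ∀ t ∈ timeInterval T, ∀ x : Sph n,
    HasDerivWithinAt (fun s => supportFn (F s) x) (-f (gaussCurvature (F t) x)) (timeInterval T) t

/-- The set of the outer radii `R (t)` of `M_t = F (Sⁿ, t)`, `0 < t < T`. -/
def outerRadii {n : ℕ} (T : EReal) (F : ℝ → Sph n → Amb n) : Set ℝ :=
  {R : ℝ | ∃ t : ℝ, 0 < t ∧ (t : EReal) < T ∧ R = outerRadius (Set.range (F t))}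

end GaussFlow

end

open scoped ContDiff Manifold RealInnerProductSpace

noncomputable section

namespace GaussFlow

open Filter Topology

/-! The largest principal radius never exceeds its initial maximum, which is `ϑ` times that of `F₀`
(`form_le_of_initial`), and `ϑ` itself is controlled by `R₀`: two fixed points of the initial
hypersurface are `ϑ ‖F₀ y - F₀ z‖` apart, hence at most `2 R₀` (`dist_initial_le`). The constant is
the quotient of these two bounds.

The monotonicity is a maximum principle (`not_isMax_form`), carried out in Euclidean space. The
one-homogeneous extension `supExt` of the support function has gradient `F` and Hessian `DF`, so the
principal radii are values of `⟪DF a, a⟫` at unit vectors. At a maximum over space, direction and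
time, the form is tested along great circles with rotated orthonormal frames
(`exists_rotated_frame`). Derivatives in fixed directions commute, so the curvature of the sphere
enters only through powers of `1 + s ^ 2`.

Convexity of the speed in the radii enters as a first-order inequality at the maximum point
(`speed_det_ge`); differentiated twice along a great circle it replaces the second-order analysis of
`f(K)`. What remains is the term `f(K) > 0`, with a sign that excludes the maximum.

Finiteness of `R₀` holds because support functions decrease and an upper bound for the support
function bounds the hypersurface (`norm_le_of_supportFn_le`). -/

/-! ### Second-order jets of functions of one variable -/

/-- `φ` is twice differentiable at `0`, with value, first and second derivative `a`, `b`, `c`. -/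
def HasTwoJet (φ : ℝ → ℝ) (a b c : ℝ) : Prop :=
  φ 0 = a ∧ ∃ φ' : ℝ → ℝ, (∀ᶠ s in 𝓝 0, HasDerivAt φ (φ' s) s) ∧ φ' 0 = b ∧ HasDerivAt φ' c 0

namespace HasTwoJet

variable {φ ψ : ℝ → ℝ} {a b c a' b' c' : ℝ}

theorem const (k : ℝ) : HasTwoJet (fun _ => k) k 0 0 :=
  ⟨rfl, fun _ => 0, Eventually.of_forall fun s => hasDerivAt_const s k, rfl, hasDerivAt_const 0 0⟩

theorem add (h : HasTwoJet φ a b c) (h' : HasTwoJet ψ a' b' c') :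
    HasTwoJet (fun s => φ s + ψ s) (a + a') (b + b') (c + c') := by
  obtain ⟨h0, φ', h1, h2, h3⟩ := h
  obtain ⟨k0, ψ', k1, k2, k3⟩ := h'
  refine ⟨by simp only [h0, k0], fun s => φ' s + ψ' s, ?_, by simp only [h2, k2], h3.add k3⟩
  filter_upwards [h1, k1] with s hs ks using hs.add ks

theorem mul (h : HasTwoJet φ a b c) (h' : HasTwoJet ψ a' b' c') :
    HasTwoJet (fun s => φ s * ψ s) (a * a') (b * a' + a * b') (c * a' + 2 * b * b' + a * c') := by
  obtain ⟨h0, φ', h1, h2, h3⟩ := h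
  obtain ⟨k0, ψ', k1, k2, k3⟩ := h'
  refine ⟨by simp only [h0, k0], fun s => φ' s * ψ s + φ s * ψ' s, ?_,
    by simp only [h0, h2, k0, k2], ?_⟩
  · filter_upwards [h1, k1] with s hs ks using hs.mul ks
  · convert! (h3.mul k1.self_of_nhds).add (h1.self_of_nhds.mul k3) using 1
    rw [h0, h2, k0, k2]; ring

theorem const_mul (k : ℝ) (h : HasTwoJet φ a b c) :
    HasTwoJet (fun s => k * φ s) (k * a) (k * b) (k * c) := by
  simpa using (const k).mul h

theorem sum {ι : Type*} (s : Finset ι) {φ : ι → ℝ → ℝ} {a b c : ι → ℝ}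
    (h : ∀ i ∈ s, HasTwoJet (φ i) (a i) (b i) (c i)) :
    HasTwoJet (fun t => ∑ i ∈ s, φ i t) (∑ i ∈ s, a i) (∑ i ∈ s, b i) (∑ i ∈ s, c i) := by
  classical
  induction s using Finset.induction_on with
  | empty => simpa using const 0
  | insert i s hi ih =>
    simp only [Finset.sum_insert hi]
    exact (h i (Finset.mem_insert_self i s)).add
      (ih fun j hj => h j (Finset.mem_insert_of_mem hj))

theorem congr (h : HasTwoJet φ a b c) (hψ : ψ =ᶠ[𝓝 0] φ) : HasTwoJet ψ a b c := by
  obtain ⟨h0, φ', h1, h2, h3⟩ := h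
  refine ⟨by rw [hψ.self_of_nhds, h0], φ', ?_, h2, h3⟩
  filter_upwards [h1, hψ.eventuallyEq_nhds] with s hs hs' using hs.congr_of_eventuallyEq hs'

theorem deriv_deriv_eq (h : HasTwoJet φ a b c) : deriv φ 0 = b ∧ deriv (deriv φ) 0 = c := by
  obtain ⟨h0, φ', h1, h2, h3⟩ := h
  have : deriv φ =ᶠ[𝓝 0] φ' := by filter_upwards [h1] with s hs using hs.deriv
  exact ⟨by rw [this.self_of_nhds, h2], by rw [this.deriv_eq, h3.deriv]⟩

/-- The second derivative is nonpositive at a local maximum. -/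
theorem nonpos_of_isLocalMax (h : HasTwoJet φ a b c) (hmax : IsLocalMax φ 0) : c ≤ 0 := by
  by_contra! hc
  obtain ⟨hd, hdd⟩ := h.deriv_deriv_eq
  have hcont : ContinuousAt φ 0 := by
    obtain ⟨-, φ', h1, -⟩ := h
    exact h1.self_of_nhds.continuousAt
  -- If `c > 0`, the point is also a local minimum, so `φ` is locally constant and `c = 0`.
  have hmin := isLocalMin_of_deriv_deriv_pos (by rw [hdd]; exact hc) hmax.deriv_eq_zero hcont
  have heq : φ =ᶠ[𝓝 0] fun _ => φ 0 := by
    filter_upwards [hmax, hmin] with s h1 h2 using le_antisymm h1 h2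
  have := ((const (φ 0)).congr heq).deriv_deriv_eq.2
  linarith

theorem one_add_sq_rpow (k p : ℝ) : HasTwoJet (fun s => (1 + k * s ^ 2) ^ p) 1 0 (2 * p * k) := by
  have hpos : ∀ᶠ s : ℝ in 𝓝 0, 0 < 1 + k * s ^ 2 := by
    have hc : ContinuousAt (fun s : ℝ => 1 + k * s ^ 2) 0 := by fun_prop
    exact hc.eventually (lt_mem_nhds (by norm_num))
  have hq : ∀ s : ℝ, HasDerivAt (fun s : ℝ => 1 + k * s ^ 2) (2 * k * s) s := fun s => by
    convert! ((hasDerivAt_pow 2 s).const_mul k).const_add 1 using 1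
    push_cast; ring
  refine ⟨by simp, fun s => 2 * k * s * p * (1 + k * s ^ 2) ^ (p - 1), ?_, by simp, ?_⟩
  · filter_upwards [hpos] with s hs using (hq s).rpow_const (Or.inl hs.ne')
  · have h1 : HasDerivAt (fun s : ℝ => 2 * k * s * p) (2 * k * p) 0 := by
      simpa using ((hasDerivAt_id (0 : ℝ)).const_mul (2 * k)).mul_const p
    have h2 := (hq 0).rpow_const (p := p - 1) (Or.inl hpos.self_of_nhds.ne')
    convert! h1.mul h2 using 1
    simp; ring

end HasTwoJet

/-! ### Iterated derivatives in fixed directions -/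

/-- The derivative of `g` in the direction `v`. -/
def dirDeriv {W V : Type*} [NormedAddCommGroup W] [NormedSpace ℝ W] [NormedAddCommGroup V]
    [NormedSpace ℝ V] (v : W) (g : W → V) (p : W) : V :=
  fderiv ℝ g p v

section DirDeriv

variable {W V : Type*} [NormedAddCommGroup W] [NormedSpace ℝ W] [NormedAddCommGroup V]
  [NormedSpace ℝ V] {Ω : Set W} {g : W → V} {p : W}

theorem contDiffOn_dirDeriv (hΩ : IsOpen Ω) (hg : ContDiffOn ℝ ∞ g Ω) (v : W) :
    ContDiffOn ℝ ∞ (dirDeriv v g) Ω :=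
  (hg.fderiv_of_isOpen hΩ (m := ∞) (by simp)).clm_apply contDiffOn_const

theorem hasFDerivAt_of_contDiffOn (hΩ : IsOpen Ω) (hg : ContDiffOn ℝ ∞ g Ω) (hp : p ∈ Ω) :
    HasFDerivAt g (fderiv ℝ g p) p :=
  ((hg.contDiffAt (hΩ.mem_nhds hp)).differentiableAt (by simp)).hasFDerivAt

theorem dirDeriv_dirDeriv (hΩ : IsOpen Ω) (hg : ContDiffOn ℝ ∞ g Ω) (hp : p ∈ Ω) (v w : W) :
    dirDeriv v (dirDeriv w g) p = fderiv ℝ (fderiv ℝ g) p v w := by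
  have h := hasFDerivAt_of_contDiffOn hΩ (hg.fderiv_of_isOpen hΩ (m := ∞) (by simp)) hp
  have := h.clm_apply (hasFDerivAt_const w p)
  have e : fderiv ℝ (dirDeriv w g) p = _ := HasFDerivAt.fderiv this
  rw [dirDeriv, e]
  simp

theorem fderiv_fderiv_symm (hΩ : IsOpen Ω) (hg : ContDiffOn ℝ ∞ g Ω) (hp : p ∈ Ω) (v w : W) :
    fderiv ℝ (fderiv ℝ g) p v w = fderiv ℝ (fderiv ℝ g) p w v := by
  refine second_derivative_symmetric_of_eventually (𝕜 := ℝ) (f := g) ?_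
    (hasFDerivAt_of_contDiffOn hΩ (hg.fderiv_of_isOpen hΩ (m := ∞) (by simp)) hp) v w
  filter_upwards [hΩ.mem_nhds hp] with q hq using hasFDerivAt_of_contDiffOn hΩ hg hq

theorem dirDeriv_comm (hΩ : IsOpen Ω) (hg : ContDiffOn ℝ ∞ g Ω) (hp : p ∈ Ω) (v w : W) :
    dirDeriv v (dirDeriv w g) p = dirDeriv w (dirDeriv v g) p := by
  rw [dirDeriv_dirDeriv hΩ hg hp, dirDeriv_dirDeriv hΩ hg hp, fderiv_fderiv_symm hΩ hg hp]

theorem dirDeriv_congr (hΩ : IsOpen Ω) {h : W → V} (hgh : Set.EqOn g h Ω) (v : W) :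
    Set.EqOn (dirDeriv v g) (dirDeriv v h) Ω := fun q hq => by
  have : g =ᶠ[𝓝 q] h := by filter_upwards [hΩ.mem_nhds hq] with r hr using hgh hr
  simp [dirDeriv, this.fderiv_eq]

theorem hasDerivAt_line {v : W} {s : ℝ} (hg : DifferentiableAt ℝ g (p + s • v)) :
    HasDerivAt (fun s : ℝ => g (p + s • v)) (dirDeriv v g (p + s • v)) s := by
  have h : HasDerivAt (fun s : ℝ => p + s • v) v s := by
    simpa using ((hasDerivAt_id s).smul_const v).const_add p
  exact hg.hasFDerivAt.comp_hasDerivAt s h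

theorem hasTwoJet_line {g : W → ℝ} (hΩ : IsOpen Ω) (hg : ContDiffOn ℝ ∞ g Ω) (hp : p ∈ Ω) (v : W) :
    HasTwoJet (fun s : ℝ => g (p + s • v)) (g p) (dirDeriv v g p)
      (dirDeriv v (dirDeriv v g) p) := by
  have hc : ContinuousAt (fun s : ℝ => p + s • v) 0 := by fun_prop
  have h : ∀ᶠ s : ℝ in 𝓝 0, p + s • v ∈ Ω :=
    hc.eventually (hΩ.mem_nhds (by simpa using hp))
  refine ⟨by simp, fun s => dirDeriv v g (p + s • v), ?_, by simp, ?_⟩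
  · filter_upwards [h] with s hs
    exact hasDerivAt_line (hasFDerivAt_of_contDiffOn hΩ hg hs).differentiableAt
  · have := hasDerivAt_line (hasFDerivAt_of_contDiffOn hΩ (contDiffOn_dirDeriv hΩ hg v)
      h.self_of_nhds).differentiableAt
    simpa using this

end DirDeriv

/-! ### Determinant inequalities and convexity of the speed -/

theorem prod_le_arith_mean_pow {n : ℕ} (hn : 0 < n) (z : Fin n → ℝ) (hz : ∀ i, 0 ≤ z i) :
    ∏ i, z i ≤ ((∑ i, z i) / n) ^ n := by
  have hn' : (0 : ℝ) < n := by exact_mod_cast hn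
  have h := Real.geom_mean_le_arith_mean Finset.univ (fun _ => (1 : ℝ)) z (by simp)
    (by simpa using hn') (fun i _ => hz i)
  simp only [Real.rpow_one, Finset.sum_const, Finset.card_univ, Fintype.card_fin, nsmul_eq_mul,
    mul_one, one_mul] at h
  have hP : 0 ≤ ∏ i, z i := Finset.prod_nonneg fun i _ => hz i
  calc ∏ i, z i = ((∏ i, z i) ^ ((n : ℝ)⁻¹)) ^ n := (Real.rpow_inv_natCast_pow hP hn.ne').symm
    _ ≤ _ := pow_le_pow_left₀ (Real.rpow_nonneg hP _) h n

theorem det_le_trace_pow {n : ℕ} (hn : 0 < n) {A : Matrix (Fin n) (Fin n) ℝ} (hA : A.PosDef) :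
    A.det ≤ (A.trace / n) ^ n := by
  rw [hA.isHermitian.det_eq_prod_eigenvalues, hA.isHermitian.trace_eq_sum_eigenvalues]
  exact prod_le_arith_mean_pow hn _ fun i => (hA.eigenvalues_pos i).le

/-- The arithmetic-geometric mean inequality for `D^{-1/2} A D^{-1/2}`, `D` diagonal. -/
theorem det_le_prod_mul_pow {n : ℕ} (hn : 0 < n) {A : Matrix (Fin n) (Fin n) ℝ} (hA : A.PosDef)
    {d : Fin n → ℝ} (hd : ∀ i, 0 < d i) :
    A.det ≤ (∏ i, d i) * ((∑ i, A i i / d i) / n) ^ n := by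
  set B : Matrix (Fin n) (Fin n) ℝ := Matrix.diagonal fun i => (√(d i))⁻¹ with hB
  have hsq : ∀ i, 0 < √(d i) := fun i => Real.sqrt_pos.2 (hd i)
  have hdet : B.det * B.det = (∏ i, d i)⁻¹ := by
    rw [hB, Matrix.det_diagonal, ← Finset.prod_mul_distrib, ← Finset.prod_inv_distrib]
    refine Finset.prod_congr rfl fun i _ => ?_
    rw [← mul_inv, Real.mul_self_sqrt (hd i).le]
  have hinj : Function.Injective B.mulVec := by
    rw [Matrix.mulVec_injective_iff_isUnit, Matrix.isUnit_iff_isUnit_det, isUnit_iff_ne_zero, hB,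
      Matrix.det_diagonal]
    exact Finset.prod_ne_zero_iff.2 fun i _ => (inv_pos.2 (hsq i)).ne'
  have hpd : (B.conjTranspose * A * B).PosDef := hA.conjTranspose_mul_mul_same hinj
  have h := det_le_trace_pow hn hpd
  have hBt : B.conjTranspose = B := by simp [hB]
  have htr : (B.conjTranspose * A * B).trace = ∑ i, A i i / d i := by
    rw [hBt, Matrix.trace]
    refine Finset.sum_congr rfl fun i _ => ?_
    rw [hB, Matrix.diag_apply, Matrix.mul_diagonal, Matrix.diagonal_mul, div_eq_mul_inv,
      ← Real.mul_self_sqrt (hd i).le, mul_inv, Real.mul_self_sqrt (hd i).le]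
    ring
  rw [htr, hBt, Matrix.det_mul, Matrix.det_mul, mul_right_comm, hdet] at h
  have hP : 0 < ∏ i, d i := Finset.prod_pos fun i _ => hd i
  rwa [inv_mul_le_iff₀ hP] at h

/-- The function `m ↦ f (K / m ^ n)` is the speed at equal radii `m * r` with `r = K ^ (-1 / n)`,
hence convex; the bound is its tangent line at `m = 1`. Convexity in the radii is needed only on
this ray. -/
theorem speed_tangent_le {n : ℕ} {f : ℝ → ℝ} (hn : 0 < n) (hf : SpeedCondition n f) {K m : ℝ}
    (hK : 0 < K) (hm : 0 < m) : f K - n * K * deriv f K * (m - 1) ≤ f (K / m ^ n) := by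
  set r : ℝ := (1 / K) ^ ((n : ℝ)⁻¹) with hr
  have hr0 : 0 < r := Real.rpow_pos_of_pos (by positivity) _
  have hrn : r ^ n = 1 / K := Real.rpow_inv_natCast_pow (by positivity) hn.ne'
  have hform : ∀ m : ℝ, f (1 / ∏ _i : Fin n, m * r) = f (K / m ^ n) := fun m => by
    congr 1
    rw [Finset.prod_const, Finset.card_univ, Fintype.card_fin, mul_pow, hrn]
    field_simp
  have hconv : ConvexOn ℝ (Set.Ioi 0) fun m : ℝ => f (K / m ^ n) := by
    refine ⟨convex_Ioi 0, fun x hx y hy a b ha hb hab => ?_⟩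
    have := hf.convex.2 (x := fun _ => x * r) (fun i => mul_pos hx hr0) (y := fun _ => y * r)
      (fun i => mul_pos hy hr0) ha hb hab
    simp only [hform] at this
    have e : (a • (fun _ : Fin n => x * r) + b • fun _ : Fin n => y * r) =
        fun _ => (a • x + b • y) * r := by
      ext i; simp; ring
    rw [e] at this
    simp only [hform] at this
    exact this
  have hdf : HasDerivAt f (deriv f K) K :=
    ((hf.smooth.contDiffAt (Ioi_mem_nhds hK)).differentiableAt (by simp)).hasDerivAt
  have hd : HasDerivAt (fun m : ℝ => f (K / m ^ n)) (deriv f K * (-(n * K))) 1 := by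
    have h1 : HasDerivAt (fun m : ℝ => K / m ^ n) (-(n * K)) 1 := by
      convert! (hasDerivAt_const (1 : ℝ) K).div (hasDerivAt_pow n (1 : ℝ)) (by simp) using 1
      simp; ring
    have h2 : HasDerivAt f (deriv f K) (K / 1 ^ n) := by simpa using hdf
    exact h2.comp (1 : ℝ) h1
  rcases lt_trichotomy m 1 with h | h | h
  · have := hconv.slope_le_of_hasDerivAt (x := m) (y := 1) hm (by simp) h hd
    rw [slope_def_field, div_le_iff₀ (by linarith)] at this
    simp only [one_pow, div_one] at this
    linarith
  · simp [h]
  · have := hconv.le_slope_of_hasDerivAt (x := 1) (y := m) (by simp) hm h hd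
    rw [slope_def_field, le_div_iff₀ (by linarith)] at this
    simp only [one_pow, div_one] at this
    linarith

theorem speed_monotone {n : ℕ} {f : ℝ → ℝ} (hf : SpeedCondition n f) :
    MonotoneOn f (Set.Ioi 0) := by
  refine monotoneOn_of_deriv_nonneg (convex_Ioi 0) hf.smooth.continuousOn ?_ ?_
  · rw [interior_Ioi]
    exact hf.smooth.differentiableOn (by simp)
  · rw [interior_Ioi]
    exact fun x hx => (hf.deriv_pos x hx).le

/-- The supporting hyperplane at a diagonal matrix of the convex function `A ↦ f (1 / det A)`. -/
theorem speed_det_ge {n : ℕ} {f : ℝ → ℝ} (hn : 0 < n) (hf : SpeedCondition n f)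
    {A : Matrix (Fin n) (Fin n) ℝ} (hA : A.PosDef) {d : Fin n → ℝ} (hd : ∀ i, 0 < d i) {K : ℝ}
    (hK : K = 1 / ∏ i, d i) :
    f K - K * deriv f K * (∑ i, A i i / d i - n) ≤ f (1 / A.det) := by
  have hn' : (0 : ℝ) < n := by exact_mod_cast hn
  have hP : 0 < ∏ i, d i := Finset.prod_pos fun i _ => hd i
  have hK0 : 0 < K := by rw [hK]; positivity
  have : Nonempty (Fin n) := ⟨⟨0, hn⟩⟩
  have hS : 0 < ∑ i, A i i / d i :=
    Finset.sum_pos (fun i _ => div_pos hA.diag_pos (hd i)) Finset.univ_nonempty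
  have h1 := speed_tangent_le hn hf hK0 (div_pos hS hn')
  -- As `f` increases, the weighted arithmetic-geometric mean inequality reduces a general matrix to
  -- the ray of equal radii.
  have h2 : f (K / ((∑ i, A i i / d i) / n) ^ n) ≤ f (1 / A.det) := by
    refine speed_monotone hf (Set.mem_Ioi.2 (by positivity))
      (Set.mem_Ioi.2 (one_div_pos.2 hA.det_pos)) ?_
    rw [hK, div_div]
    exact one_div_le_one_div_of_le hA.det_pos (det_le_prod_mul_pow hn hA hd)
  refine le_trans (le_of_eq ?_) (h1.trans h2)
  field_simp

/-! ### Radial extension of maps on the sphere -/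

open Metric Module

/-- Stereographic charts are restrictions of maps smooth on an open set of the ambient space, so
smoothness into the sphere can be tested after inclusion. -/
theorem contMDiffOn_sphere_of_coe {E W : Type*} [NormedAddCommGroup E] [InnerProductSpace ℝ E]
    [NormedAddCommGroup W] [NormedSpace ℝ W]
    {n : ℕ} [Fact (finrank ℝ E = n + 1)] {m : ℕ∞ω} {s : Set W}
    {f : W → sphere (0 : E) 1} (hf : ContDiffOn ℝ m (fun x => (f x : E)) s) :
    ContMDiffOn 𝓘(ℝ, W) (𝓡 n) m f s := by
  rw [contMDiffOn_iff_target]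
  refine ⟨continuousOn_iff_continuous_domRestrict.2 (continuous_induced_rng.2
    (continuousOn_iff_continuous_domRestrict.1 hf.continuousOn)), ?_⟩
  intro v
  let U : _ ≃ₗᵢ[ℝ] _ :=
    (OrthonormalBasis.fromOrthogonalSpanSingleton
        n (ne_zero_of_mem_unit_sphere (-v))).repr
  have h : ContDiffOn ℝ ω _ Set.univ := U.contDiff.contDiffOn
  have H₁ := (h.comp_inter contDiffOn_stereoToFun).contMDiffOn
  convert! (H₁.of_le le_top).comp' hf.contMDiffOn using 1
  ext x
  -- The chart centred at `v` omits only the pole `-v`, which this equation describes.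
  have hfxv : f x = -v ↔ ⟪(f x : E), -(v : E)⟫ = 1 := by
    have hv : ‖-(v : E)‖ = 1 := by simp
    rw [inner_eq_one_iff_of_norm_eq_one (norm_eq_of_mem_sphere (f x)) hv]
    exact Subtype.ext_iff
  simp [chartAt, ChartedSpace.chartAt, hfxv, real_inner_comm]

variable {n : ℕ}

/-- The first coordinate vector, a point of the sphere. -/
def basePoint (n : ℕ) : Sph n := ⟨EuclideanSpace.single 0 1, by simp⟩

/-- The direction `y / ‖y‖` of a vector, as a point of the sphere. -/
def sphDir (y : Amb n) : Sph n :=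
  open Classical in
  if h : y = 0 then basePoint n
  else ⟨‖y‖⁻¹ • y, by simp [norm_smul, inv_mul_cancel₀ (norm_ne_zero_iff.mpr h)]⟩

theorem coe_sphDir {y : Amb n} (h : y ≠ 0) : (sphDir y : Amb n) = ‖y‖⁻¹ • y := by
  simp [sphDir, h]

theorem radialExt_eq {V : Type*} [Zero V] (G : Sph n → V) {y : Amb n} (h : y ≠ 0) :
    radialExt G y = G (sphDir y) := by
  simp [radialExt, sphDir, h]

theorem sph_ne_zero (x : Sph n) : (x : Amb n) ≠ 0 := ne_zero_of_mem_unit_sphere x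

theorem sphDir_coe (x : Sph n) : sphDir (x : Amb n) = x := by
  ext1
  rw [coe_sphDir (sph_ne_zero x)]
  simp

theorem sphDir_smul {c : ℝ} (hc : 0 < c) {y : Amb n} (h : y ≠ 0) : sphDir (c • y) = sphDir y := by
  ext1
  rw [coe_sphDir (smul_ne_zero hc.ne' h), coe_sphDir h, norm_smul, Real.norm_of_nonneg hc.le,
    smul_smul]
  congr 1
  field_simp

theorem contDiffOn_sphDir : ContDiffOn ℝ ∞ (fun y : Amb n => (sphDir y : Amb n)) {0}ᶜ := by
  have h : ContDiffOn ℝ ∞ (fun y : Amb n => ‖y‖⁻¹ • y) {0}ᶜ := by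
    intro y hy
    have hy' : y ≠ 0 := hy
    exact (((contDiffAt_norm ℝ hy').inv (by simpa using hy')).smul contDiffAt_id).contDiffWithinAt
  exact h.congr fun y hy => coe_sphDir hy

theorem contDiffOn_radialExt {F : Sph n → Amb n} (hF : ContMDiff (𝓡 n) 𝓘(ℝ, Amb n) ∞ F) :
    ContDiffOn ℝ ∞ (radialExt F) {0}ᶜ := by
  have h := hF.comp_contMDiffOn (contMDiffOn_sphere_of_coe (n := n) contDiffOn_sphDir)
  exact (contMDiffOn_iff_contDiffOn.1 h).congr fun y hy => radialExt_eq F hy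

theorem contDiffOn_radialExt_prod {F : ℝ → Sph n → Amb n} {I : Set ℝ}
    (hF : ContMDiffOn (𝓘(ℝ, ℝ).prod (𝓡 n)) 𝓘(ℝ, Amb n) ∞ (fun p : ℝ × Sph n => F p.1 p.2)
      (I ×ˢ Set.univ)) :
    ContDiffOn ℝ ∞ (fun p : ℝ × Amb n => radialExt (F p.1) p.2) (I ×ˢ {0}ᶜ) := by
  have h2 : ContDiffOn ℝ ∞ (fun p : ℝ × Amb n => (sphDir p.2 : Amb n)) (I ×ˢ {0}ᶜ) :=
    contDiffOn_sphDir.comp contDiff_snd.contDiffOn fun p hp => hp.2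
  have h1 : ContMDiffOn 𝓘(ℝ, ℝ × Amb n) 𝓘(ℝ, ℝ) ∞ (fun p : ℝ × Amb n => p.1) (I ×ˢ {0}ᶜ) :=
    contDiff_fst.contDiffOn.contMDiffOn
  have h := hF.comp (h1.prodMk (contMDiffOn_sphere_of_coe (n := n) h2))
    fun p hp => ⟨hp.1, Set.mem_univ _⟩
  exact (contMDiffOn_iff_contDiffOn.1 h).congr fun p hp => radialExt_eq _ hp.2

theorem isOpen_compl_zero : IsOpen ({0}ᶜ : Set (Amb n)) := isOpen_compl_singleton

/-- The one-homogeneous extension of the support function. -/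
def supExt (F : Sph n → Amb n) (y : Amb n) : ℝ := ⟪radialExt F y, y⟫

theorem supExt_eq (F : Sph n → Amb n) {y : Amb n} (hy : y ≠ 0) :
    supExt F y = ‖y‖ * supportFn F (sphDir y) := by
  have h := norm_ne_zero_iff.2 hy
  rw [supExt, supportFn, radialExt_eq F hy, coe_sphDir hy, inner_smul_right]
  field_simp

theorem radialExt_coe {V : Type*} [Zero V] (G : Sph n → V) (x : Sph n) :
    radialExt G (x : Amb n) = G x := by
  rw [radialExt_eq G (sph_ne_zero x), sphDir_coe]

theorem radialExt_smul (F : Sph n → Amb n) {c : ℝ} (hc : 0 < c) {y : Amb n} (hy : y ≠ 0) :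
    radialExt F (c • y) = radialExt F y := by
  rw [radialExt_eq F (smul_ne_zero hc.ne' hy), radialExt_eq F hy, sphDir_smul hc hy]

section Smooth

variable {F : Sph n → Amb n} (hF : ContMDiff (𝓡 n) 𝓘(ℝ, Amb n) ∞ F)
include hF

theorem hasFDerivAt_radialExt {y : Amb n} (hy : y ≠ 0) :
    HasFDerivAt (radialExt F) (fderiv ℝ (radialExt F) y) y :=
  hasFDerivAt_of_contDiffOn isOpen_compl_zero (contDiffOn_radialExt hF) hy

/-- The extension is constant along rays. -/
theorem fderiv_radialExt_self {y : Amb n} (hy : y ≠ 0) : fderiv ℝ (radialExt F) y y = 0 := by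
  have h0 : y + (0 : ℝ) • y = y := by simp
  have h := hasDerivAt_line (p := y) (v := y) (s := 0) (g := radialExt F)
    (by rw [h0]; exact (hasFDerivAt_radialExt hF hy).differentiableAt)
  rw [h0] at h
  have h' : (fun s : ℝ => radialExt F (y + s • y)) =ᶠ[𝓝 0] fun _ => radialExt F y := by
    filter_upwards [lt_mem_nhds (show (-1 : ℝ) < 0 by norm_num)] with s hs
    have e : y + s • y = (1 + s) • y := by rw [add_smul, one_smul]
    rw [e, radialExt_smul F (by linarith) hy]
  exact h.unique ((hasDerivAt_const (0 : ℝ) _).congr_of_eventuallyEq h')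

theorem fderiv_radialExt_smul {y : Amb n} (hy : y ≠ 0) {c : ℝ} (hc : 0 < c) (a : Amb n) :
    fderiv ℝ (radialExt F) y a = c • fderiv ℝ (radialExt F) (c • y) a := by
  have hcy := smul_ne_zero hc.ne' hy
  have h : HasFDerivAt (radialExt F ∘ fun z => c • id z) _ y :=
    (hasFDerivAt_radialExt hF hcy).comp y ((hasFDerivAt_id y).const_smul c)
  have h' : (radialExt F ∘ fun z => c • id z) =ᶠ[𝓝 y] radialExt F := by
    filter_upwards [isOpen_compl_zero.mem_nhds hy] with z hz using radialExt_smul F hc hz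
  rw [← h'.fderiv_eq, h.fderiv]
  simp

end Smooth

/-! ### The Hessian of the extended support function and the Gauss curvature -/

section Convex

variable {F : Sph n → Amb n} (hF : IsStrictlyConvex F)
include hF

theorem inner_fderiv_coe (x : Sph n) (a : Amb n) :
    ⟪fderiv ℝ (radialExt F) (x : Amb n) a, (x : Amb n)⟫ = 0 := by
  have hx : ⟪(x : Amb n), (x : Amb n)⟫ = 1 := by simp
  have hb : a - ⟪(x : Amb n), a⟫ • (x : Amb n) ∈ Tan x := by
    rw [Submodule.mem_orthogonal_singleton_iff_inner_right, inner_sub_right, inner_smul_right, hx]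
    ring
  have h := hF.normal x ⟨_, hb⟩
  simpa [tangentDeriv, fderiv_radialExt_self hF.smooth (sph_ne_zero x)] using h

/-- The derivative of a degree-zero extension is homogeneous of degree `-1`, which carries normality
from the sphere to all nonzero points. -/
theorem inner_fderiv_self {y : Amb n} (hy : y ≠ 0) (a : Amb n) :
    ⟪fderiv ℝ (radialExt F) y a, y⟫ = 0 := by
  have hpos : 0 < ‖y‖ := norm_pos_iff.2 hy
  have h := inner_fderiv_coe hF (sphDir y) a
  rw [coe_sphDir hy, inner_smul_right] at h
  rw [fderiv_radialExt_smul hF.smooth hy (inv_pos.2 hpos) a, inner_smul_left]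
  exact h

/-- The product rule leaves the extra term `⟪DF a, y⟫`, which vanishes by normality: the gradient of
the support function is the position vector. -/
theorem hasFDerivAt_supExt {y : Amb n} (hy : y ≠ 0) :
    HasFDerivAt (supExt F) (innerSL ℝ (radialExt F y)) y := by
  have h := (hasFDerivAt_radialExt hF.smooth hy).inner ℝ (hasFDerivAt_id y)
  refine h.congr_fderiv ?_
  ext a
  simp [inner_fderiv_self hF hy a]

theorem contDiffOn_supExt : ContDiffOn ℝ ∞ (supExt F) {0}ᶜ :=
  (contDiffOn_radialExt hF.smooth).inner ℝ contDiffOn_id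

theorem dirDeriv_supExt {y : Amb n} (hy : y ≠ 0) (a : Amb n) :
    dirDeriv a (supExt F) y = ⟪radialExt F y, a⟫ := by
  rw [dirDeriv, (hasFDerivAt_supExt hF hy).fderiv]; simp

theorem dirDeriv_dirDeriv_supExt {y : Amb n} (hy : y ≠ 0) (a b : Amb n) :
    dirDeriv a (dirDeriv b (supExt F)) y = ⟪fderiv ℝ (radialExt F) y a, b⟫ := by
  rw [dirDeriv_congr isOpen_compl_zero (fun z hz => dirDeriv_supExt hF hz b) a hy, dirDeriv]
  have h := (hasFDerivAt_radialExt hF.smooth hy).inner ℝ (hasFDerivAt_const b y)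
  rw [h.fderiv]
  simp

theorem fderiv_symm {y : Amb n} (hy : y ≠ 0) (a b : Amb n) :
    ⟪fderiv ℝ (radialExt F) y a, b⟫ = ⟪fderiv ℝ (radialExt F) y b, a⟫ := by
  rw [← dirDeriv_dirDeriv_supExt hF hy, ← dirDeriv_dirDeriv_supExt hF hy]
  exact dirDeriv_comm isOpen_compl_zero (contDiffOn_supExt hF) hy a b

theorem fderiv_pos (x : Sph n) {a : Amb n} (ha : ⟪(x : Amb n), a⟫ = 0) (ha0 : a ≠ 0) :
    0 < ⟪fderiv ℝ (radialExt F) (x : Amb n) a, a⟫ :=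
  hF.convex x ⟨a, Submodule.mem_orthogonal_singleton_iff_inner_right.2 ha⟩
    fun h => ha0 (congrArg Subtype.val h)

/-- The radial direction is in the kernel of `DF` and orthogonal to its range, so the form sees only
tangential parts. -/
theorem inner_fderiv_add_smul (x : Sph n) (a : Amb n) (c : ℝ) :
    ⟪fderiv ℝ (radialExt F) (x : Amb n) (a + c • (x : Amb n)), a + c • (x : Amb n)⟫ =
      ⟪fderiv ℝ (radialExt F) (x : Amb n) a, a⟫ := by
  rw [map_add, map_smul, fderiv_radialExt_self hF.smooth (sph_ne_zero x), smul_zero, add_zero,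
    inner_add_right, inner_smul_right, inner_fderiv_coe hF]
  ring

theorem fderiv_nonneg_coe (x : Sph n) (a : Amb n) :
    0 ≤ ⟪fderiv ℝ (radialExt F) (x : Amb n) a, a⟫ := by
  have hx : ⟪(x : Amb n), (x : Amb n)⟫ = 1 := by simp
  have h := inner_fderiv_add_smul hF x a (-⟪(x : Amb n), a⟫)
  set b := a + (-⟪(x : Amb n), a⟫) • (x : Amb n) with hb
  rw [← h]
  by_cases hb0 : b = 0
  · simp [hb0]
  · refine (fderiv_pos hF x ?_ hb0).le
    rw [hb, inner_add_right, inner_smul_right, hx]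
    ring

theorem fderiv_nonneg {y : Amb n} (hy : y ≠ 0) (a : Amb n) :
    0 ≤ ⟪fderiv ℝ (radialExt F) y a, a⟫ := by
  have hpos : 0 < ‖y‖ := norm_pos_iff.2 hy
  have h := fderiv_nonneg_coe hF (sphDir y) a
  rw [coe_sphDir hy] at h
  rw [fderiv_radialExt_smul hF.smooth hy (inv_pos.2 hpos) a, inner_smul_left]
  exact mul_nonneg (inv_pos.2 hpos).le h

/-- The matrix of the second fundamental form in an orthonormal frame is positive definite, and the
Gauss curvature is the inverse of its determinant. -/
theorem posDef_secondForm (x : Sph n) {w : Fin n → Amb n} (hw : Orthonormal ℝ w)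
    (hwx : ∀ i, ⟪(x : Amb n), w i⟫ = 0) :
    (Matrix.of fun i j => ⟪fderiv ℝ (radialExt F) (x : Amb n) (w i), w j⟫).PosDef := by
  refine Matrix.PosDef.of_dotProduct_mulVec_pos ?_ fun c hc => ?_
  · ext i j
    simpa using fderiv_symm hF (sph_ne_zero x) (w j) (w i)
  · have hne : ∑ i, c i • w i ≠ 0 := fun h => hc <| funext <|
      Fintype.linearIndependent_iff.1 hw.linearIndependent c h
    have h := fderiv_pos hF x (a := ∑ i, c i • w i)
      (by simp [inner_sum, inner_smul_right, hwx]) hne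
    refine h.trans_eq ?_
    simp only [map_sum, map_smul, sum_inner, inner_sum, inner_smul_left, inner_smul_right,
      dotProduct, Matrix.mulVec, Matrix.of_apply, Finset.mul_sum, Pi.star_apply]
    refine Finset.sum_congr rfl fun i _ => Finset.sum_congr rfl fun j _ => ?_
    rw [fderiv_symm hF (sph_ne_zero x) (w i) (w j)]
    simp only [conj_trivial, star_trivial]
    ring

theorem gaussCurvature_eq (x : Sph n) {w : Fin n → Amb n} (hw : Orthonormal ℝ w)
    (hwx : ∀ i, ⟪(x : Amb n), w i⟫ = 0) :
    gaussCurvature F x =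
      1 / (Matrix.of fun i j => ⟪fderiv ℝ (radialExt F) (x : Amb n) (w i), w j⟫).det := by
  set D := fderiv ℝ (radialExt F) (x : Amb n) with hD
  set ε := stdOrthonormalBasis ℝ (Tan x) with hε
  have hfin : finrank ℝ (Tan x) = n :=
    Submodule.finrank_orthogonal_span_singleton (sph_ne_zero x)
  have hmem : ∀ a, D a ∈ Tan x := fun a => by
    rw [Submodule.mem_orthogonal_singleton_iff_inner_right, real_inner_comm]
    exact inner_fderiv_coe hF x a
  set A := Matrix.of fun i j => secondForm F x (ε i) (ε j) with hA
  -- `D` maps into the tangent space, so Parseval turns the metric into `A * Aᵀ` and its determinant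
  -- into the square of `A.det`.
  have hg : (Matrix.of fun i j => inducedMetric F x (ε i) (ε j)) = A * A.transpose := by
    ext i j
    simp only [Matrix.mul_apply, Matrix.transpose_apply, hA, Matrix.of_apply, secondForm,
      inducedMetric, tangentDeriv]
    have h := ε.sum_inner_mul_inner ⟨D (ε i), hmem _⟩ ⟨D (ε j), hmem _⟩
    simp only [Submodule.coe_inner] at h
    rw [← hD, ← h]
    exact Finset.sum_congr rfl fun k _ => by rw [real_inner_comm (ε k : Amb n) (D (ε j))]
  have hK : gaussCurvature F x = 1 / A.det := by
    rw [gaussCurvature, hg, Matrix.det_mul, Matrix.det_transpose]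
    -- With the convention `a / 0 = 0` the degenerate case is consistent and needs no separate
    -- exclusion.
    rcases eq_or_ne A.det 0 with h | h
    · simp [← hε, ← hA, h]
    · rw [← hε, ← hA]; field_simp
  set e : Fin (finrank ℝ (Tan x)) ≃ Fin n := finCongr hfin with he
  set B : Matrix (Fin n) (Fin (finrank ℝ (Tan x))) ℝ := Matrix.of fun i j => ⟪w i, ε j⟫ with hB
  have hwm : ∀ i, w i ∈ Tan x := fun i =>
    Submodule.mem_orthogonal_singleton_iff_inner_right.2 (hwx i)
  have hexp : ∀ i, w i = ∑ k, B i k • (ε k : Amb n) := fun i => by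
    have h := ε.sum_repr' ⟨w i, hwm i⟩
    have h' := congrArg Subtype.val h
    simp only [Submodule.coe_sum, Submodule.coe_smul, Submodule.coe_inner] at h'
    refine h'.symm.trans (Finset.sum_congr rfl fun k _ => ?_)
    rw [hB, Matrix.of_apply, real_inner_comm]
  have hBB : B * B.transpose = 1 := by
    ext i j
    have h := ε.sum_inner_mul_inner ⟨w i, hwm i⟩ ⟨w j, hwm j⟩
    simp only [Submodule.coe_inner] at h
    rw [orthonormal_iff_ite.1 hw i j] at h
    rw [Matrix.one_apply, ← h, Matrix.mul_apply]
    exact Finset.sum_congr rfl fun k _ => by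
      simp only [hB, Matrix.transpose_apply, Matrix.of_apply]
      rw [real_inner_comm (w j)]
  have hAw : (Matrix.of fun i j => ⟪D (w i), w j⟫) = B * A * B.transpose := by
    ext i j
    rw [Matrix.of_apply, hexp i, hexp j]
    simp only [map_sum, map_smul, sum_inner, inner_sum, inner_smul_left, inner_smul_right,
      Matrix.mul_apply, Matrix.transpose_apply, Finset.sum_mul, Finset.mul_sum, hA,
      Matrix.of_apply, secondForm, tangentDeriv]
    refine Finset.sum_congr rfl fun k _ => Finset.sum_congr rfl fun l _ => ?_
    rw [conj_trivial, ← hD]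
    ring
  rw [hK, hAw]
  congr 1
  -- Reindexing makes the change-of-frame matrix square, hence orthogonal, so it drops out of the
  -- determinant.
  set B' : Matrix (Fin n) (Fin n) ℝ := B.submatrix id e.symm with hB'
  set A' : Matrix (Fin n) (Fin n) ℝ := A.submatrix e.symm e.symm with hA'
  have h1 : B' * B'.transpose = 1 := by
    rw [hB', Matrix.transpose_submatrix, Matrix.submatrix_mul_equiv, hBB, Matrix.submatrix_id_id]
  have h2 : B * A * B.transpose = B' * A' * B'.transpose := by
    rw [hB', hA', Matrix.transpose_submatrix, Matrix.submatrix_mul_equiv,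
      Matrix.submatrix_mul_equiv, Matrix.submatrix_id_id]
  rw [h2, Matrix.det_mul_right_comm, h1, one_mul, hA', Matrix.det_submatrix_equiv_self]

end Convex

/-! ### Principal radii and size of a convex hypersurface -/

section Convex

variable {F : Sph n → Amb n} (hF : IsStrictlyConvex F)
include hF

/-- Along `x + s a` the degree-zero extension of `u` is `(1 + ‖a‖² s²) ^ (-1/2)` times the
one-homogeneous one; the second derivative of this factor contributes `-‖a‖² u`, which the added
term cancels. -/
theorem sphereHess_supportFn (x : Sph n) (a : Tan x) :
    sphereHess (supportFn F) x a a + supportFn F x * ‖a‖ ^ 2 =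
      ⟪fderiv ℝ (radialExt F) (x : Amb n) a, (a : Amb n)⟫ := by
  have hext : Set.EqOn (radialExt (supportFn F)) (fun y => ‖y‖⁻¹ * supExt F y) {0}ᶜ :=
    fun y hy => by
      have hy' : y ≠ 0 := hy
      simp only [radialExt_eq _ hy', supExt_eq F hy']
      field_simp [norm_ne_zero_iff.2 hy']
  have hsm : ContDiffOn ℝ ∞ (radialExt (supportFn F)) {0}ᶜ := by
    refine ContDiffOn.congr (fun y hy => ?_) hext
    have hy' : y ≠ 0 := hy
    exact ((contDiffAt_norm ℝ hy').inv (by simpa using hy')).contDiffWithinAt.mul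
      (contDiffOn_supExt hF y hy)
  have h1 := hasTwoJet_line isOpen_compl_zero hsm (sph_ne_zero x) (a : Amb n)
  have hxa : ⟪(x : Amb n), (a : Amb n)⟫ = 0 :=
    Submodule.mem_orthogonal_singleton_iff_inner_right.1 a.2
  have hnorm : ∀ s : ℝ, ‖(x : Amb n) + s • (a : Amb n)‖ ^ 2 = 1 + ‖a‖ ^ 2 * s ^ 2 := fun s => by
    rw [norm_add_sq_real, inner_smul_right, hxa, norm_smul, mul_pow]
    simp [mul_comm]
  have h2 := (HasTwoJet.one_add_sq_rpow (‖a‖ ^ 2) (-(1 / 2))).mul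
    (hasTwoJet_line isOpen_compl_zero (contDiffOn_supExt hF) (sph_ne_zero x) (a : Amb n))
  have h3 := h2.congr (ψ := fun s : ℝ => radialExt (supportFn F) ((x : Amb n) + s • (a : Amb n)))
    (Eventually.of_forall fun s => by
      have hne : (x : Amb n) + s • (a : Amb n) ≠ 0 := fun h => by
        have := hnorm s
        rw [h, norm_zero] at this
        nlinarith [sq_nonneg ‖a‖, sq_nonneg s, mul_nonneg (sq_nonneg ‖a‖) (sq_nonneg s)]
      simp only [hext hne]
      congr 1
      rw [← hnorm s, Real.rpow_neg (sq_nonneg _), ← Real.sqrt_eq_rpow, Real.sqrt_sq (norm_nonneg _)])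
  have h4 := h1.deriv_deriv_eq.2.symm.trans h3.deriv_deriv_eq.2
  rw [dirDeriv_dirDeriv isOpen_compl_zero hsm (sph_ne_zero x),
    dirDeriv_dirDeriv_supExt hF (sph_ne_zero x)] at h4
  rw [sphereHess, h4, supExt_eq F (sph_ne_zero x), sphDir_coe]
  simp
  ring

/-- Eigenvalues of the matrix `w_ij` are values of the second fundamental form at unit vectors. -/
theorem exists_eq_of_hasEigenvalue (x : Sph n) (e : OrthonormalBasis (Fin n) ℝ (Tan x)) {χ : ℝ}
    (h : Module.End.HasEigenvalue (Matrix.toLin' (radiiMatrix (supportFn F) x e)) χ) :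
    ∃ a : Sph n, ⟪fderiv ℝ (radialExt F) (x : Amb n) a, (a : Amb n)⟫ = χ := by
  obtain ⟨c, hc⟩ := h.exists_hasEigenvector
  have hW := hc.apply_eq_smul
  rw [Matrix.toLin'_apply] at hW
  set b : Tan x := ∑ i, c i • e i with hb
  have hrep : ∀ i, ⟪e i, b⟫ = c i := fun i => by
    rw [hb, e.orthonormal.inner_right_fintype]
  have hb0 : b ≠ 0 := fun h0 => hc.2 <| funext fun i => by rw [← hrep i, h0]; simp
  have hnb : ‖b‖ ^ 2 = ∑ i, c i * c i := by
    rw [← e.sum_sq_norm_inner_right b]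
    refine Finset.sum_congr rfl fun i _ => ?_
    rw [hrep, Real.norm_eq_abs, sq_abs, sq]
  have hquad : ⟪fderiv ℝ (radialExt F) (x : Amb n) b, (b : Amb n)⟫ = χ * ‖b‖ ^ 2 := by
    rw [← sphereHess_supportFn hF x b]
    have h1 : sphereHess (supportFn F) x b b =
        ∑ i, ∑ j, c i * c j * sphereHess (supportFn F) x (e i) (e j) := by
      simp only [sphereHess, hb, Submodule.coe_sum, Submodule.coe_smul, map_sum, map_smul,
        sum_apply, smul_apply, smul_eq_mul, Finset.mul_sum]
      rw [Finset.sum_comm]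
      exact Finset.sum_congr rfl fun i _ => Finset.sum_congr rfl fun j _ => by ring
    have h2 : c ⬝ᵥ (radiiMatrix (supportFn F) x e).mulVec c = χ * ‖b‖ ^ 2 := by
      rw [hW, dotProduct_smul, hnb, smul_eq_mul]
      rfl
    rw [← h2, h1, hnb]
    simp only [dotProduct, Matrix.mulVec, radiiMatrix, Matrix.of_apply, Finset.mul_sum, add_mul,
      mul_add, Finset.sum_add_distrib]
    congr 1
    · exact Finset.sum_congr rfl fun i _ => Finset.sum_congr rfl fun j _ => by ring
    · refine Finset.sum_congr rfl fun i _ => ?_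
      rw [Finset.sum_eq_single i (fun j _ hj => by simp [hj.symm]) (by simp)]
      simp; ring
  have hnb0 : ‖b‖ ≠ 0 := norm_ne_zero_iff.2 hb0
  have hnb0' : ‖(b : Amb n)‖ ≠ 0 := hnb0
  refine ⟨⟨‖b‖⁻¹ • (b : Amb n), by simp [norm_smul, hb0]⟩, ?_⟩
  simp only [map_smul, inner_smul_left, inner_smul_right, conj_trivial, hquad]
  field_simp

/-- Along a segment avoiding the origin `supExt F` is convex with gradient `F x` at `x`, so it lies
above its tangent there. -/
theorem inner_le_supExt (x : Sph n) {y : Amb n}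
    (hy : ∀ s ∈ Set.Icc (0 : ℝ) 1, (x : Amb n) + s • (y - x) ≠ 0) : ⟪F x, y⟫ ≤ supExt F y := by
  set v := y - (x : Amb n) with hv
  have hd : ∀ s ∈ Set.Icc (0 : ℝ) 1, HasDerivAt (fun s : ℝ => supExt F ((x : Amb n) + s • v))
      ⟪radialExt F ((x : Amb n) + s • v), v⟫ s := fun s hs => by
    have h := hasDerivAt_line (hasFDerivAt_supExt hF (hy s hs)).differentiableAt
    rwa [dirDeriv_supExt hF (hy s hs)] at h
  have hdd : ∀ s ∈ Set.Icc (0 : ℝ) 1,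
      HasDerivAt (fun s : ℝ => ⟪radialExt F ((x : Amb n) + s • v), v⟫)
        ⟪fderiv ℝ (radialExt F) ((x : Amb n) + s • v) v, v⟫ s := fun s hs => by
    have h := (hasDerivAt_line (hasFDerivAt_radialExt hF.smooth (hy s hs)).differentiableAt).inner ℝ
      (hasDerivAt_const s v)
    simpa [dirDeriv] using h
  have hmono : MonotoneOn (fun s : ℝ => ⟪radialExt F ((x : Amb n) + s • v), v⟫)
      (Set.Icc 0 1) := by
    refine monotoneOn_of_deriv_nonneg (convex_Icc 0 1)
      (fun s hs => (hdd s hs).continuousAt.continuousWithinAt) ?_ ?_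
    · exact fun s hs => (hdd s (interior_subset hs)).differentiableAt.differentiableWithinAt
    · intro s hs
      rw [(hdd s (interior_subset hs)).deriv]
      exact fderiv_nonneg hF (hy s (interior_subset hs)) v
  obtain ⟨ξ, hξ, h⟩ := exists_hasDerivAt_eq_slope (fun s : ℝ => supExt F ((x : Amb n) + s • v)) _
    zero_lt_one (fun s hs => (hd s hs).continuousAt.continuousWithinAt)
    (fun s hs => hd s (Set.Ioo_subset_Icc_self hs))
  have h0 := hmono (Set.left_mem_Icc.2 zero_le_one) (Set.Ioo_subset_Icc_self hξ) hξ.1.le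
  have hx1 : (x : Amb n) + (1 : ℝ) • v = y := by rw [hv]; simp
  simp only [zero_smul, add_zero, radialExt_coe] at h0
  simp only [hx1, zero_smul, add_zero, sub_zero, div_one] at h
  rw [h] at h0
  have hxx : supExt F (x : Amb n) = ⟪F x, (x : Amb n)⟫ := by rw [supExt, radialExt_coe]
  rw [hxx, hv, inner_sub_right] at h0
  linarith

/-- Testing `⟪F x, y⟫ ≤ B ‖y‖` with `y = F x` would give the bound `B`. The segment from `x` to `y`
meets the origin when `F x` is a nonpositive multiple of `x`; avoiding this costs the factor `2`. -/
theorem norm_le_of_supportFn_le (hn : 0 < n) {B : ℝ} (hB0 : 0 ≤ B)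
    (hB : ∀ z, supportFn F z ≤ B) (x : Sph n) : ‖F x‖ ≤ 2 * B := by
  have hle : ∀ y : Amb n, (∀ c : ℝ, 0 ≤ c → y ≠ -(c • (x : Amb n))) → ⟪F x, y⟫ ≤ B * ‖y‖ := by
    intro y hy
    have hy0 : y ≠ 0 := by simpa using hy 0 le_rfl
    refine (inner_le_supExt hF x fun s hs h => ?_).trans ?_
    · rcases hs.1.eq_or_lt with h0 | h0
      · rw [← h0, zero_smul, add_zero] at h
        exact sph_ne_zero x h
      · refine hy ((1 - s) / s) (div_nonneg (by linarith [hs.2]) h0.le) ?_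
        have h' : s • y = -((1 - s) • (x : Amb n)) := by
          rw [eq_neg_iff_add_eq_zero]
          exact Eq.trans (by module) h
        rw [← smul_right_injective _ h0.ne' |>.eq_iff]
        simp only [h', smul_neg, smul_smul]
        congr 2
        field_simp
    · rw [supExt_eq F hy0, mul_comm]
      exact mul_le_mul_of_nonneg_right (hB _) (norm_nonneg y)
  by_cases hp : ∀ c : ℝ, 0 ≤ c → F x ≠ -(c • (x : Amb n))
  · have h := hle _ hp
    have hp0 : F x ≠ 0 := by simpa using hp 0 le_rfl
    rw [real_inner_self_eq_norm_sq, sq] at h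
    have := le_of_mul_le_mul_right h (norm_pos_iff.2 hp0)
    linarith
  · push Not at hp
    obtain ⟨c, hc, hcx⟩ := hp
    have hnF : ‖F x‖ = c := by rw [hcx, norm_neg, norm_smul]; simp [abs_of_nonneg hc]
    rw [hnF]
    rcases hc.eq_or_lt with h0 | h0
    · rw [← h0]; positivity
    have hfin : finrank ℝ (Tan x) = n := Submodule.finrank_orthogonal_span_singleton (sph_ne_zero x)
    set ε := stdOrthonormalBasis ℝ (Tan x)
    set a : Tan x := ε ⟨0, by rw [hfin]; exact hn⟩ with ha
    have han : ‖(a : Amb n)‖ = 1 := ε.norm_eq_one _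
    have hxa : ⟪(x : Amb n), (a : Amb n)⟫ = 0 :=
      Submodule.mem_orthogonal_singleton_iff_inner_right.1 a.2
    have haa : ⟪(a : Amb n), (a : Amb n)⟫ = 1 := by rw [real_inner_self_eq_norm_sq, han]; simp
    have hxx : ⟪(x : Amb n), (x : Amb n)⟫ = 1 := by simp
    -- Shifting by `c` times a unit tangent vector leaves the bad ray, while the inner product stays
    -- `c ^ 2` and the norm is at most `2 * c`.
    have h := hle (F x + c • (a : Amb n)) fun d _ hd => by
      have := congrArg (fun z => ⟪(a : Amb n), z⟫) hd
      rw [hcx] at this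
      simp only [inner_add_right, inner_neg_right, inner_smul_right, real_inner_comm, hxa, haa] at this
      simp at this
      exact h0.ne' this
    have hn2 : ‖F x + c • (a : Amb n)‖ ≤ 2 * c := by
      refine (norm_add_le _ _).trans ?_
      rw [hnF, norm_smul, han, Real.norm_of_nonneg hc]
      linarith
    have hin : ⟪F x, F x + c • (a : Amb n)⟫ = c * c := by
      rw [inner_add_right, real_inner_self_eq_norm_sq, hnF, hcx, inner_neg_left, inner_smul_left,
        inner_smul_right, hxa]
      simp; ring
    rw [hin] at h
    have h3 := h.trans (mul_le_mul_of_nonneg_left hn2 hB0)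
    refine le_of_mul_le_mul_right ?_ h0
    linarith

end Convex

/-! ### Outer radius -/

theorem bddBelow_radii (M : Set (Amb n)) :
    BddBelow {r : ℝ | 0 ≤ r ∧ ∃ z : Amb n, M ⊆ closedBall z r} :=
  ⟨0, fun _ hr => hr.1⟩

theorem outerRadius_le {M : Set (Amb n)} {B : ℝ} (hB : 0 ≤ B) (h : ∀ p ∈ M, ‖p‖ ≤ B) :
    outerRadius M ≤ B :=
  csInf_le (bddBelow_radii M) ⟨hB, 0, fun p hp => by simpa using h p hp⟩

/-- Points of a ball of radius `r` are at most `2 r` apart. Boundedness makes the set of admissible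
radii nonempty, without which its infimum would say nothing. -/
theorem dist_le_outerRadius {M : Set (Amb n)} (hM : Bornology.IsBounded M) {p q : Amb n}
    (hp : p ∈ M) (hq : q ∈ M) : ‖p - q‖ ≤ 2 * outerRadius M := by
  obtain ⟨R, hR⟩ := hM.subset_closedBall 0
  have h : ‖p - q‖ / 2 ≤ outerRadius M := by
    refine le_csInf ⟨max R 0, le_max_right _ _, 0, hR.trans (closedBall_subset_closedBall
      (le_max_left _ _))⟩ ?_
    rintro r ⟨-, z, hz⟩
    have h1 := mem_closedBall.1 (hz hp)
    have h2 := mem_closedBall.1 (hz hq)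
    have h3 := dist_triangle_right p q z
    rw [dist_eq_norm] at h3
    linarith
  linarith

/-! ### Principal frames and their rotation -/

section Frames

variable {F : Sph n → Amb n} (hF : IsStrictlyConvex F)
include hF

/-- The principal directions at `x`; the largest principal radius bounds the second fundamental
form at unit vectors. -/
theorem exists_principal_frame (hn : 0 < n) (x : Sph n) :
    ∃ (w : Fin n → Amb n) (μ : Fin n → ℝ), Orthonormal ℝ w ∧ (∀ i, ⟪(x : Amb n), w i⟫ = 0) ∧
      (∀ i, fderiv ℝ (radialExt F) (x : Amb n) (w i) = μ i • w i) ∧ (∀ i, 0 < μ i) ∧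
      ∀ a : Sph n, ∃ i, ⟪fderiv ℝ (radialExt F) (x : Amb n) a, (a : Amb n)⟫ ≤ μ i := by
  set D := fderiv ℝ (radialExt F) (x : Amb n) with hD
  have hfin : finrank ℝ (Tan x) = n :=
    Submodule.finrank_orthogonal_span_singleton (sph_ne_zero x)
  have hmem : ∀ a : Tan x, (D.toLinearMap ∘ₗ (Tan x).subtype) a ∈ Tan x := fun a => by
    rw [Submodule.mem_orthogonal_singleton_iff_inner_right, real_inner_comm]
    exact inner_fderiv_coe hF x a
  set S : Tan x →ₗ[ℝ] Tan x := LinearMap.codRestrict (Tan x) (D.toLinearMap ∘ₗ (Tan x).subtype) hmem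
    with hS
  have hScoe : ∀ a, (S a : Amb n) = D a := fun a => rfl
  have hSymm : S.IsSymmetric := fun a b => by
    rw [Submodule.coe_inner, Submodule.coe_inner, hScoe, hScoe, hD, fderiv_symm hF (sph_ne_zero x),
      real_inner_comm]
  set b := hSymm.eigenvectorBasis hfin with hb
  set μ := hSymm.eigenvalues hfin with hμ
  have hSb : ∀ i, S (b i) = μ i • b i := fun i => hSymm.apply_eigenvectorBasis hfin i
  have hDb : ∀ i, D (b i) = μ i • (b i : Amb n) := fun i => by
    rw [← hScoe, hSb]; rfl
  have hx : ∀ a : Tan x, ⟪(x : Amb n), (a : Amb n)⟫ = 0 := fun a =>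
    Submodule.mem_orthogonal_singleton_iff_inner_right.1 a.2
  have hμpos : ∀ i, 0 < μ i := fun i => by
    have h := fderiv_pos hF x (hx (b i)) fun h0 => by
      have := b.norm_eq_one i
      rw [Submodule.coe_norm, h0, norm_zero] at this
      exact zero_ne_one this
    rw [← hD, hDb, inner_smul_left, ← Submodule.coe_inner, real_inner_self_eq_norm_sq,
      b.norm_eq_one] at h
    simpa using h
  refine ⟨fun i => b i, μ, b.orthonormal.comp_linearIsometry (Tan x).subtypeₗᵢ,
    fun i => hx _, hDb, hμpos, fun a => ?_⟩
  have : Nonempty (Fin n) := ⟨⟨0, hn⟩⟩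
  obtain ⟨k, hk⟩ := Finite.exists_max μ
  refine ⟨k, ?_⟩
  have hxx : ⟪(x : Amb n), (x : Amb n)⟫ = 1 := by simp
  -- The unit vector `a` need not be tangent: its projection has norm at most one and the same form
  -- value, and `μ k > 0` lets the norm be dropped.
  have h := inner_fderiv_add_smul hF x (a : Amb n) (-⟪(x : Amb n), (a : Amb n)⟫)
  set a' := (a : Amb n) + (-⟪(x : Amb n), (a : Amb n)⟫) • (x : Amb n) with ha'
  have ham : a' ∈ Tan x := by
    rw [Submodule.mem_orthogonal_singleton_iff_inner_right, ha', inner_add_right, inner_smul_right,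
      hxx]
    ring
  have hna : ‖a'‖ ^ 2 ≤ 1 := by
    have e : ‖a'‖ ^ 2 = 1 - ⟪(x : Amb n), (a : Amb n)⟫ ^ 2 := by
      rw [ha', norm_add_sq_real, inner_smul_right, norm_smul, real_inner_comm]
      simp
      ring
    rw [e]
    linarith [sq_nonneg ⟪(x : Amb n), (a : Amb n)⟫]
  have hsum : ⟪D a', a'⟫ = ∑ i, μ i * ⟪b i, ⟨a', ham⟩⟫ ^ 2 := by
    have h1 := b.sum_inner_mul_inner (S ⟨a', ham⟩) ⟨a', ham⟩
    rw [Submodule.coe_inner, hScoe] at h1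
    rw [← h1]
    refine Finset.sum_congr rfl fun i _ => ?_
    rw [hSymm, hSb, inner_smul_right, real_inner_comm]
    ring
  have hpars : ∑ i, ⟪b i, ⟨a', ham⟩⟫ ^ 2 = ‖a'‖ ^ 2 := by
    have := b.sum_sq_norm_inner_right ⟨a', ham⟩
    simpa using this
  rw [← h, ← hD, hsum]
  calc ∑ i, μ i * ⟪b i, ⟨a', ham⟩⟫ ^ 2 ≤ ∑ i, μ k * ⟪b i, ⟨a', ham⟩⟫ ^ 2 :=
        Finset.sum_le_sum fun i _ => mul_le_mul_of_nonneg_right (hk i) (sq_nonneg _)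
    _ = μ k * ‖a'‖ ^ 2 := by rw [← Finset.mul_sum, hpars]
    _ ≤ μ k := mul_le_of_le_one_right (hμpos k).le hna

/-- The exponent of `1 + s ^ 2` that appears when the `j`-th vector of a frame is rotated and the
`i`-th diagonal entry of the second fundamental form is considered. -/
def frameExp (i j : Fin n) : ℝ := if i = j then 3 / 2 else 1 / 2

omit hF in
theorem norm_add_smul_sq (x : Sph n) {v : Amb n} (hv : ‖v‖ = 1) (hxv : ⟪(x : Amb n), v⟫ = 0)
    (s : ℝ) : ‖(x : Amb n) + s • v‖ ^ 2 = 1 + s ^ 2 := by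
  rw [norm_add_sq_real, inner_smul_right, hxv, norm_smul, hv]
  simp

omit hF in
theorem add_smul_ne_zero (x : Sph n) {v : Amb n} (hv : ‖v‖ = 1) (hxv : ⟪(x : Amb n), v⟫ = 0)
    (s : ℝ) : (x : Amb n) + s • v ≠ 0 := fun h => by
  have := norm_add_smul_sq x hv hxv s
  rw [h, norm_zero] at this
  nlinarith [sq_nonneg s]

omit hF in
theorem norm_add_smul (x : Sph n) {v : Amb n} (hv : ‖v‖ = 1) (hxv : ⟪(x : Amb n), v⟫ = 0)
    (s : ℝ) : ‖(x : Amb n) + s • v‖ = (1 + s ^ 2) ^ (1 / 2 : ℝ) := by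
  rw [← norm_add_smul_sq x hv hxv s, ← Real.sqrt_eq_rpow, Real.sqrt_sq (norm_nonneg _)]

/-- Rotation of an orthonormal frame along the great circle in the direction of its `j`-th
vector. -/
theorem exists_rotated_frame (x : Sph n) {w : Fin n → Amb n} (hw : Orthonormal ℝ w)
    (hwx : ∀ i, ⟪(x : Amb n), w i⟫ = 0) (j : Fin n) (s : ℝ) :
    ∃ w' : Fin n → Amb n, Orthonormal ℝ w' ∧
      (∀ i, ⟪(sphDir ((x : Amb n) + s • w j) : Amb n), w' i⟫ = 0) ∧
      ∀ i, ⟪fderiv ℝ (radialExt F) (sphDir ((x : Amb n) + s • w j) : Amb n) (w' i), w' i⟫ =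
        (1 + s ^ 2) ^ frameExp i j *
          ⟪fderiv ℝ (radialExt F) ((x : Amb n) + s • w j) (w i), w i⟫ := by
  have hxx : ⟪(x : Amb n), (x : Amb n)⟫ = 1 := by simp
  have hww := orthonormal_iff_ite.1 hw
  have hxw : ∀ i, ⟪w i, (x : Amb n)⟫ = 0 := fun i => by rw [real_inner_comm, hwx]
  set y := (x : Amb n) + s • w j with hy
  have hN2 := norm_add_smul_sq x (hw.1 j) (hwx j) s
  have hN := norm_add_smul x (hw.1 j) (hwx j) s
  have hy0 : y ≠ 0 := add_smul_ne_zero x (hw.1 j) (hwx j) s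
  rw [← hy] at hN hN2
  have hNpos : 0 < ‖y‖ := norm_pos_iff.2 hy0
  have hD : ∀ a, fderiv ℝ (radialExt F) (sphDir y : Amb n) a =
      ‖y‖ • fderiv ℝ (radialExt F) y a := fun a => by
    rw [coe_sphDir hy0, fderiv_radialExt_smul hF.smooth hy0 (inv_pos.2 hNpos) a, smul_smul,
      mul_inv_cancel₀ hNpos.ne', one_smul]
  have hpos : (0 : ℝ) < 1 + s ^ 2 := by positivity
  refine ⟨fun i => if i = j then ‖y‖⁻¹ • (w j - s • (x : Amb n)) else w i, ?_, ?_, ?_⟩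
  · rw [orthonormal_iff_ite]
    intro a b
    by_cases ha : a = j <;> by_cases hb : b = j
    · subst ha; subst hb
      simp only [if_true, inner_smul_left, inner_smul_right, inner_sub_left, inner_sub_right, hww,
        hxw, hwx, hxx, conj_trivial]
      field_simp
      rw [hN2]; ring
    · subst ha
      simp [hb, inner_smul_left, inner_sub_left, hww, hwx, Ne.symm hb]
    · subst hb
      simp [ha, inner_smul_right, inner_sub_right, hww, hxw]
    · simp [ha, hb, hww]
  · intro i
    rw [coe_sphDir hy0, inner_smul_left, hy]
    by_cases hi : i = j
    · subst hi
      simp only [if_true, inner_smul_right, inner_add_left, inner_sub_right, inner_smul_left, hww,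
        hxw, hwx, hxx, conj_trivial]
      simp
    · simp [hi, inner_add_left, inner_smul_left, hww, hwx, Ne.symm hi]
  · intro i
    rw [hD]
    by_cases hi : i = j
    · subst hi
      -- Modulo the kernel vector `y`, the rotated vector is `(1 + s ^ 2) • w i` before
      -- normalization. Squaring, dividing by `‖y‖ ^ 2` and multiplying by `‖y‖` from homogeneity
      -- gives the exponent `2 - 1 + 1/2 = 3/2`.
      have e : w i - s • (x : Amb n) = (1 + s ^ 2) • w i - s • y := by rw [hy]; module
      have hQ : ⟪fderiv ℝ (radialExt F) y (w i - s • (x : Amb n)), w i - s • (x : Amb n)⟫ =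
          (1 + s ^ 2) ^ 2 * ⟪fderiv ℝ (radialExt F) y (w i), w i⟫ := by
        rw [e]
        simp only [map_sub, map_smul, fderiv_radialExt_self hF.smooth hy0, smul_zero, sub_zero,
          inner_sub_right, inner_smul_left, inner_smul_right, inner_fderiv_self hF hy0,
          conj_trivial]
        ring
      have h3 : (1 + s ^ 2) ^ (3 / 2 : ℝ) = ‖y‖ ^ 3 := by
        rw [hN, ← Real.rpow_mul_natCast hpos.le]; norm_num
      simp only [if_true, frameExp, map_smul, inner_smul_left, inner_smul_right, conj_trivial, hQ]
      rw [h3, ← hN2]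
      field_simp
    · simp only [hi, if_false, frameExp, inner_smul_left, conj_trivial, hN]

end Frames

/-! ### Calculus in time and space -/

/-- Backward difference quotients are nonnegative. Only earlier times are compared because the
maximum may lie at the final time of the interval considered. -/
theorem nonneg_of_le_left {h : ℝ → ℝ} {c t₀ : ℝ} (hd : HasDerivAt h c t₀)
    (hle : ∀ᶠ t in 𝓝[<] t₀, h t ≤ h t₀) : 0 ≤ c := by
  have hs := (hasDerivWithinAt_iff_tendsto_slope' (s := Set.Iio t₀) (by simp)).1
    hd.hasDerivWithinAt
  refine ge_of_tendsto hs ?_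
  filter_upwards [hle, self_mem_nhdsWithin] with t ht htt
  rw [slope_def_field]
  exact div_nonneg_of_nonpos (by linarith) (by have : t < t₀ := htt; linarith)

section Product

variable {W V : Type*} [NormedAddCommGroup W] [NormedSpace ℝ W] [NormedAddCommGroup V]
  [NormedSpace ℝ V] {g : ℝ × W → V} {t : ℝ} {y : W}

theorem dirDeriv_prod_right (hg : DifferentiableAt ℝ g (t, y)) (v : W) :
    dirDeriv ((0 : ℝ), v) g (t, y) = dirDeriv v (fun z => g (t, z)) y := by
  have h : HasFDerivAt (fun z => g (t, z)) _ y := hg.hasFDerivAt.comp y (hasFDerivAt_prodMk_right t y)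
  rw [dirDeriv, dirDeriv, h.fderiv]
  simp

theorem hasDerivAt_prod_left (hg : DifferentiableAt ℝ g (t, y)) :
    HasDerivAt (fun s => g (s, y)) (dirDeriv ((1 : ℝ), (0 : W)) g (t, y)) t :=
  hg.hasFDerivAt.comp_hasDerivAt t ((hasDerivAt_id t).prodMk (hasDerivAt_const t y))

end Product

theorem dirDeriv_dirDeriv_comm {W : Type*} [NormedAddCommGroup W] [NormedSpace ℝ W] {Ω : Set W}
    {g : W → ℝ} (hΩ : IsOpen Ω) (hg : ContDiffOn ℝ ∞ g Ω) (v w : W) :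
    Set.EqOn (dirDeriv v (dirDeriv v (dirDeriv w g))) (dirDeriv w (dirDeriv v (dirDeriv v g))) Ω :=
  fun p hp => by
    rw [dirDeriv_congr hΩ (fun q hq => dirDeriv_comm hΩ hg hq v w) v hp,
      dirDeriv_comm hΩ (contDiffOn_dirDeriv hΩ hg v) hp]

/-! ### The maximum principle along the flow -/

/-- The open time interval `(0, T)`. -/
def openTime (T : EReal) : Set ℝ := {t : ℝ | 0 < t ∧ (t : EReal) < T}

theorem isOpen_openTime (T : EReal) : IsOpen (openTime T) :=
  (isOpen_lt continuous_const continuous_id).inter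
    (isOpen_lt continuous_coe_real_ereal continuous_const)

theorem openTime_subset (T : EReal) : openTime T ⊆ timeInterval T := fun _ ht => ⟨ht.1.le, ht.2⟩

theorem mem_timeInterval_of_le {T : EReal} {s t : ℝ} (ht : t ∈ timeInterval T) (hs : 0 ≤ s)
    (hst : s ≤ t) : s ∈ timeInterval T :=
  ⟨hs, (EReal.coe_le_coe_iff.2 hst).trans_lt ht.2⟩

theorem convex_timeInterval (T : EReal) : Convex ℝ (timeInterval T) := by
  refine Set.OrdConnected.convex ⟨fun a ha b hb c hc => ?_⟩
  exact mem_timeInterval_of_le hb (ha.1.trans hc.1) hc.2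

theorem openTime_nonempty {T : EReal} (hT : 0 < T) : (openTime T).Nonempty := by
  obtain ⟨t, h1, h2⟩ := EReal.lt_iff_exists_real_btwn.1 hT
  exact ⟨t, by exact_mod_cast h1, h2⟩

section Flow

variable {f : ℝ → ℝ} {ϑ : ℝ} {F₀ : Sph n → Amb n} {T : EReal} {F : ℝ → Sph n → Amb n}
  (hF : IsFlow f ϑ F₀ T F)
include hF

theorem contDiffOn_flow :
    ContDiffOn ℝ ∞ (fun p : ℝ × Amb n => radialExt (F p.1) p.2) (timeInterval T ×ˢ {0}ᶜ) :=
  contDiffOn_radialExt_prod hF.smooth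

theorem uniqueDiffOn_flow : UniqueDiffOn ℝ (timeInterval T ×ˢ ({0}ᶜ : Set (Amb n))) := by
  refine (uniqueDiffOn_convex (convex_timeInterval T) ?_).prod isOpen_compl_zero.uniqueDiffOn
  exact (openTime_nonempty hF.time_pos).mono
    (interior_maximal (openTime_subset T) (isOpen_openTime T))

/-- Writing the spatial derivative through the derivative within the closed-at-zero time domain
gives joint continuity down to `t = 0`. -/
theorem fderiv_slice_eq {t : ℝ} (ht : t ∈ timeInterval T) {y : Amb n} (hy : y ≠ 0) (a : Amb n) :
    fderiv ℝ (radialExt (F t)) y a =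
      fderivWithin ℝ (fun p : ℝ × Amb n => radialExt (F p.1) p.2) (timeInterval T ×ˢ {0}ᶜ) (t, y)
        (0, a) := by
  have h := (((contDiffOn_flow hF).differentiableOn (by simp)) (t, y) ⟨ht, hy⟩).hasFDerivWithinAt
  have h' : HasFDerivWithinAt (radialExt (F t)) _ {0}ᶜ y :=
    h.comp y (hasFDerivAt_prodMk_right t y).hasFDerivWithinAt fun z hz => ⟨ht, hz⟩
  rw [(h'.hasFDerivAt (isOpen_compl_zero.mem_nhds hy)).fderiv]
  simp

/-- The second fundamental form at unit vectors is jointly continuous up to the initial time. -/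
theorem continuousOn_form :
    ContinuousOn (fun q : ℝ × Sph n × Sph n =>
      ⟪fderiv ℝ (radialExt (F q.1)) (q.2.1 : Amb n) q.2.2, (q.2.2 : Amb n)⟫)
      (timeInterval T ×ˢ Set.univ) := by
  have h := (contDiffOn_flow hF).continuousOn_fderivWithin (uniqueDiffOn_flow hF) (by simp)
  have h1 : ContinuousOn (fun q : ℝ × Sph n × Sph n => (q.1, (q.2.1 : Amb n)))
      (timeInterval T ×ˢ Set.univ) := by fun_prop
  have h2 := h.comp h1 fun q hq => ⟨hq.1, sph_ne_zero q.2.1⟩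
  have h3 : ContinuousOn (fun q : ℝ × Sph n × Sph n => ((0 : ℝ), (q.2.2 : Amb n)))
      (timeInterval T ×ˢ Set.univ) := by fun_prop
  have h4 : ContinuousOn (fun q : ℝ × Sph n × Sph n => (q.2.2 : Amb n))
      (timeInterval T ×ˢ Set.univ) := by fun_prop
  refine ((h2.clm_apply h3).inner (𝕜 := ℝ) h4).congr fun q hq => ?_
  simp only [fderiv_slice_eq hF hq.1 (sph_ne_zero q.2.1)]
  rfl

theorem contDiffOn_supExt_flow :
    ContDiffOn ℝ ∞ (fun p : ℝ × Amb n => supExt (F p.1) p.2) (openTime T ×ˢ {0}ᶜ) :=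
  ((contDiffOn_flow hF).mono (Set.prod_mono (openTime_subset T) subset_rfl)).inner ℝ
    contDiff_snd.contDiffOn

omit hF in
theorem isOpen_flowDomain : IsOpen (openTime T ×ˢ ({0}ᶜ : Set (Amb n))) :=
  (isOpen_openTime T).prod isOpen_compl_zero

theorem dirDeriv_dirDeriv_flow {t : ℝ} (ht : t ∈ openTime T) {y : Amb n} (hy : y ≠ 0)
    (v w : Amb n) :
    dirDeriv ((0 : ℝ), v) (dirDeriv ((0 : ℝ), w) fun p : ℝ × Amb n => supExt (F p.1) p.2) (t, y) =
      ⟪fderiv ℝ (radialExt (F t)) y v, w⟫ := by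
  have hg := contDiffOn_supExt_flow hF
  have hc := hF.strictlyConvex t (openTime_subset T ht)
  have h1 : ∀ z : Amb n, z ≠ 0 →
      dirDeriv ((0 : ℝ), w) (fun p : ℝ × Amb n => supExt (F p.1) p.2) (t, z) =
        dirDeriv w (supExt (F t)) z := fun z hz =>
    dirDeriv_prod_right (hasFDerivAt_of_contDiffOn isOpen_flowDomain hg
      (p := (t, z)) ⟨ht, hz⟩).differentiableAt w
  rw [dirDeriv_prod_right (hasFDerivAt_of_contDiffOn isOpen_flowDomain
      (contDiffOn_dirDeriv isOpen_flowDomain hg _) (p := (t, y)) ⟨ht, hy⟩).differentiableAt,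
    dirDeriv_congr isOpen_compl_zero (h1 · ·) v hy, dirDeriv_dirDeriv_supExt hc hy]

theorem dirDeriv_time_flow {t : ℝ} (ht : t ∈ openTime T) {y : Amb n} (hy : y ≠ 0) :
    dirDeriv ((1 : ℝ), (0 : Amb n)) (fun p : ℝ × Amb n => supExt (F p.1) p.2) (t, y) =
      -(‖y‖ * f (gaussCurvature (F t) (sphDir y))) := by
  have h1 := hasDerivAt_prod_left (hasFDerivAt_of_contDiffOn isOpen_flowDomain
    (contDiffOn_supExt_flow hF) (p := (t, y)) ⟨ht, hy⟩).differentiableAt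
  have h2 := ((hF.evolution t (openTime_subset T ht) (sphDir y)).hasDerivAt
    (mem_of_superset ((isOpen_openTime T).mem_nhds ht) (openTime_subset T))).const_mul ‖y‖
  have h3 : (fun s => supExt (F s) y) = fun s => ‖y‖ * supportFn (F s) (sphDir y) :=
    funext fun s => supExt_eq (F s) hy
  have h4 : HasDerivAt (fun s => supExt (F s) y) _ t := h1
  rw [h3] at h4
  rw [h4.unique h2]
  ring

/-- In the principal frame at the maximum, `Q i` is the second derivative of the extended support
function in the fixed direction `w i`. Maximality gives a sign for the time derivative of `Q k` and
for its second derivatives in every `w i`; the twice differentiated flow equation contradicts them.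
-/
theorem not_isMax_form (hn : 0 < n) (hf : SpeedCondition n f) {t₀ : ℝ} (ht₀ : t₀ ∈ openTime T)
    (x₀ a₀ : Sph n)
    (hmax : ∀ t, 0 ≤ t → t ≤ t₀ → ∀ x a : Sph n,
      ⟪fderiv ℝ (radialExt (F t)) (x : Amb n) a, (a : Amb n)⟫ ≤
        ⟪fderiv ℝ (radialExt (F t₀)) (x₀ : Amb n) a₀, (a₀ : Amb n)⟫) : False := by
  set lam := ⟪fderiv ℝ (radialExt (F t₀)) (x₀ : Amb n) a₀, (a₀ : Amb n)⟫ with hlam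
  have hc := hF.strictlyConvex t₀ (openTime_subset T ht₀)
  obtain ⟨w, μ, hw, hwx, hDw, hμ, htop⟩ := exists_principal_frame hc hn x₀
  have hval : ∀ i, ⟪fderiv ℝ (radialExt (F t₀)) (x₀ : Amb n) (w i), w i⟫ = μ i := fun i => by
    rw [hDw, inner_smul_left, real_inner_self_eq_norm_sq, hw.1 i]; simp
  have hform : ∀ t, 0 ≤ t → t ≤ t₀ → ∀ (x : Sph n) (v : Amb n), ‖v‖ = 1 →
      ⟪fderiv ℝ (radialExt (F t)) (x : Amb n) v, v⟫ ≤ lam := fun t h0 h1 x v hv =>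
    hmax t h0 h1 x ⟨v, by simpa using hv⟩
  have hμle : ∀ i, μ i ≤ lam := fun i => by
    rw [← hval]; exact hform t₀ ht₀.1.le le_rfl x₀ _ (hw.1 i)
  obtain ⟨k, hk⟩ := htop a₀
  have hμk : μ k = lam := le_antisymm (hμle k) hk
  set Ω := openTime T ×ˢ ({0}ᶜ : Set (Amb n)) with hΩdef
  have hΩ : IsOpen Ω := isOpen_flowDomain
  set g : ℝ × Amb n → ℝ := fun p => supExt (F p.1) p.2 with hgdef
  have hg : ContDiffOn ℝ ∞ g Ω := contDiffOn_supExt_flow hF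
  set E : Fin n → ℝ × Amb n := fun i => (0, w i) with hE
  set τ : ℝ × Amb n := (1, 0) with hτ
  set Q : Fin n → ℝ × Amb n → ℝ := fun i => dirDeriv (E i) (dirDeriv (E i) g) with hQdef
  have hQsm : ∀ i, ContDiffOn ℝ ∞ (Q i) Ω := fun i =>
    contDiffOn_dirDeriv hΩ (contDiffOn_dirDeriv hΩ hg _) _
  have hQ : ∀ t ∈ openTime T, ∀ (y : Amb n), y ≠ 0 → ∀ i,
      Q i (t, y) = ⟪fderiv ℝ (radialExt (F t)) y (w i), w i⟫ := fun t ht y hy i =>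
    dirDeriv_dirDeriv_flow hF ht hy _ _
  set p₀ : ℝ × Amb n := (t₀, (x₀ : Amb n)) with hp₀
  have hp₀Ω : p₀ ∈ Ω := ⟨ht₀, sph_ne_zero x₀⟩
  have hQp₀ : ∀ i, Q i p₀ = μ i := fun i => by rw [hp₀, hQ t₀ ht₀ _ (sph_ne_zero x₀), hval]
  have hline : ∀ (i : Fin n) (s : ℝ), p₀ + s • E i = (t₀, (x₀ : Amb n) + s • w i) := fun i s => by
    simp [hp₀, hE]
  have hyne : ∀ (i : Fin n) (s : ℝ), (x₀ : Amb n) + s • w i ≠ 0 := fun i s =>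
    add_smul_ne_zero x₀ (hw.1 i) (hwx i) s
  have hjet : ∀ p : ℝ, HasTwoJet (fun s : ℝ => (1 + s ^ 2) ^ p) 1 0 (2 * p) := fun p => by
    simpa using HasTwoJet.one_add_sq_rpow 1 p
  -- time derivative at the maximum
  have htime : 0 ≤ dirDeriv τ (Q k) p₀ := by
    refine nonneg_of_le_left (hasDerivAt_prod_left
      (hasFDerivAt_of_contDiffOn hΩ (hQsm k) hp₀Ω).differentiableAt) ?_
    filter_upwards [self_mem_nhdsWithin,
      nhdsWithin_le_nhds ((isOpen_openTime T).mem_nhds ht₀)] with t ht htT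
    have h1 : Q k (t₀, (x₀ : Amb n)) = lam := (hQp₀ k).trans hμk
    rw [h1, hQ t htT _ (sph_ne_zero x₀)]
    exact hform t htT.1.le (le_of_lt ht) x₀ _ (hw.1 k)
  -- spatial second derivatives at the maximum
  have hspace : ∀ i, 2 * frameExp k i * lam + dirDeriv (E i) (dirDeriv (E i) (Q k)) p₀ ≤ 0 := by
    intro i
    have hj := (hjet (frameExp k i)).mul (hasTwoJet_line hΩ (hQsm k) hp₀Ω (E i))
    -- The product is the form at the rotated unit vector `w' k`, so it is at most `lam`, with
    -- equality at `s = 0`.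
    have hle := hj.nonpos_of_isLocalMax (Eventually.of_forall fun s => by
      obtain ⟨w', hw', -, hA⟩ := exists_rotated_frame hc x₀ hw hwx i s
      simp only [hline, hQ t₀ ht₀ _ (hyne i _), ← hA]
      simp only [zero_smul, add_zero, hval, hμk]
      norm_num
      exact hform t₀ ht₀.1.le le_rfl _ _ (hw'.1 k))
    rw [hQp₀, hμk] at hle
    linarith
  -- the evolution equation along the great circle in the direction of `w k`
  set K₀ := gaussCurvature (F t₀) x₀ with hK₀
  have hK₀eq : K₀ = 1 / ∏ i, μ i := by
    rw [hK₀, gaussCurvature_eq hc x₀ hw hwx]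
    congr 1
    rw [← Matrix.det_diagonal]
    congr 1
    ext i j
    rw [Matrix.of_apply, hDw, inner_smul_left, orthonormal_iff_ite.1 hw, Matrix.diagonal_apply]
    simp
  have hK₀pos : 0 < K₀ := by
    rw [hK₀eq]; exact one_div_pos.2 (Finset.prod_pos fun i _ => hμ i)
  have hspeed : dirDeriv (E k) (dirDeriv (E k) (dirDeriv τ g)) p₀ + (f K₀ - K₀ * deriv f K₀ *
      ∑ i, (2 * frameExp i k * μ i + dirDeriv (E k) (dirDeriv (E k) (Q i)) p₀) / μ i) ≤ 0 := by
    have hsum := HasTwoJet.sum Finset.univ fun i _ =>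
      ((hjet (frameExp i k)).mul (hasTwoJet_line hΩ (hQsm i) hp₀Ω (E k))).const_mul (μ i)⁻¹
    have hbr := (HasTwoJet.const (f K₀ + K₀ * deriv f K₀ * n)).add
      (hsum.const_mul (-(K₀ * deriv f K₀)))
    -- This function is `‖y‖` times the tangent bound minus the actual speed: nonpositive by
    -- `speed_det_ge` and zero at `s = 0`, so its second derivative there is nonpositive.
    have hj := (hasTwoJet_line hΩ (contDiffOn_dirDeriv hΩ hg τ) hp₀Ω (E k)).add
      ((hjet (1 / 2)).mul hbr)
    have hcard : ∑ i, (μ i)⁻¹ * (1 * Q i p₀) = n := by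
      simp only [hQp₀, one_mul, inv_mul_cancel₀ (hμ _).ne']
      simp
    have hle := hj.nonpos_of_isLocalMax (Eventually.of_forall fun s => by
      have h0 : dirDeriv τ g p₀ = -f K₀ := by
        rw [hp₀, dirDeriv_time_flow hF ht₀ (sph_ne_zero x₀), sphDir_coe, ← hK₀]
        simp
      obtain ⟨w', hw', hwx', hA⟩ := exists_rotated_frame hc x₀ hw hwx k s
      have hdet := speed_det_ge hn hf (posDef_secondForm hc _ hw' hwx') hμ hK₀eq
      rw [← gaussCurvature_eq hc _ hw' hwx'] at hdet
      simp only [Matrix.of_apply, hA] at hdet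
      have e0 : (1 : ℝ) + 0 ^ 2 = 1 := by norm_num
      simp only [zero_smul, add_zero, e0, Real.one_rpow, h0, hcard]
      simp only [hline, hQ t₀ ht₀ _ (hyne k _)]
      rw [dirDeriv_time_flow hF ht₀ (hyne k s), norm_add_smul x₀ (hw.1 k) (hwx k) s]
      have hp : (0 : ℝ) < (1 + s ^ 2) ^ (1 / 2 : ℝ) := by positivity
      have hdet' := mul_le_mul_of_nonneg_left hdet hp.le
      simp only [div_eq_inv_mul] at hdet'
      nlinarith [hdet'])
    have hs2 : ∑ i, (2 * frameExp i k * μ i + dirDeriv (E k) (dirDeriv (E k) (Q i)) p₀) / μ i =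
        ∑ i, (μ i)⁻¹ * (2 * frameExp i k * Q i p₀ + 2 * 0 * dirDeriv (E k) (Q i) p₀ +
          1 * dirDeriv (E k) (dirDeriv (E k) (Q i)) p₀) :=
      Finset.sum_congr rfl fun i _ => by rw [hQp₀, div_eq_inv_mul]; ring
    rw [hs2]
    rw [hcard] at hle
    linarith
  -- The directions are constant vectors, so fourth derivatives commute without curvature terms.
  have hcomm4 : ∀ i, dirDeriv (E k) (dirDeriv (E k) (Q i)) p₀ =
      dirDeriv (E i) (dirDeriv (E i) (Q k)) p₀ := fun i => by
    rw [dirDeriv_dirDeriv_comm hΩ (contDiffOn_dirDeriv hΩ hg (E i)) (E k) (E i) hp₀Ω]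
    exact dirDeriv_congr hΩ (dirDeriv_dirDeriv_comm hΩ hg (E k) (E i)) (E i) hp₀Ω
  have hcomm3 := dirDeriv_dirDeriv_comm hΩ hg (E k) τ hp₀Ω
  have hexp : ∀ i, frameExp i k = frameExp k i := fun i => by simp [frameExp, eq_comm]
  have hexp0 : ∀ i j : Fin n, 0 ≤ frameExp i j := fun i j => by
    unfold frameExp; split_ifs <;> norm_num
  -- The derivative term is at most `-2 * frameExp k i * lam`, and `μ i ≤ lam`, so each summand is
  -- nonpositive.
  have hsumle : ∑ i, (2 * frameExp i k * μ i + dirDeriv (E k) (dirDeriv (E k) (Q i)) p₀) / μ i ≤ 0 :=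
    Finset.sum_nonpos fun i _ => div_nonpos_of_nonpos_of_nonneg (by
      rw [hcomm4, hexp]
      have h1 := hspace i
      have h2 := mul_le_mul_of_nonneg_left (hμle i) (hexp0 k i)
      linarith) (hμ i).le
  have hfd : 0 < K₀ * deriv f K₀ := mul_pos hK₀pos (hf.deriv_pos K₀ hK₀pos)
  have h5 := mul_nonpos_of_nonneg_of_nonpos hfd.le hsumle
  -- The strictly positive zeroth-order term, due to the factor `‖y‖` in the flow equation, closes
  -- the contradiction.
  have h6 := hf.pos K₀ hK₀pos
  rw [hcomm3] at hspeed
  linarith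

/-- The largest principal radius does not exceed its initial maximum. -/
theorem form_le_of_initial (hn : 0 < n) (hf : SpeedCondition n f) {M : ℝ}
    (h0 : ∀ x a : Sph n, ⟪fderiv ℝ (radialExt (F 0)) (x : Amb n) a, (a : Amb n)⟫ ≤ M)
    {t : ℝ} (ht : t ∈ timeInterval T) (x a : Sph n) :
    ⟪fderiv ℝ (radialExt (F t)) (x : Amb n) a, (a : Amb n)⟫ ≤ M := by
  have hsub : Set.Icc 0 t ×ˢ (Set.univ : Set (Sph n × Sph n)) ⊆ timeInterval T ×ˢ Set.univ :=
    Set.prod_mono (fun s hs => mem_timeInterval_of_le ht hs.1 hs.2) subset_rfl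
  -- Compactness gives a maximum over times, points and directions together; it must occur at time
  -- zero.
  obtain ⟨⟨t₀, x₀, a₀⟩, hmem, hmax⟩ := (isCompact_Icc.prod isCompact_univ).exists_isMaxOn
    ⟨(t, x, a), ⟨⟨ht.1, le_rfl⟩, Set.mem_univ _⟩⟩ ((continuousOn_form hF).mono hsub)
  have hle := fun s (h1 : 0 ≤ s) (h2 : s ≤ t) y b =>
    isMaxOn_iff.1 hmax (s, y, b) ⟨⟨h1, h2⟩, Set.mem_univ _⟩
  rcases hmem.1.1.eq_or_lt with h | h
  · simp only at h
    refine (hle t ht.1 le_rfl x a).trans ?_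
    simp only [← h]
    exact h0 x₀ a₀
  · exact (not_isMax_form hF hn hf ⟨h, (hsub hmem).1.2⟩ x₀ a₀ fun s h1 h2 y b =>
      hle s h1 (h2.trans hmem.1.2) y b).elim

theorem supportFn_le_initial (hn : 0 < n) (hf : SpeedCondition n f) {t : ℝ}
    (ht : t ∈ timeInterval T) (x : Sph n) : supportFn (F t) x ≤ supportFn (F 0) x := by
  have hd := hF.evolution
  have h0 : (0 : ℝ) ∈ timeInterval T := mem_timeInterval_of_le ht le_rfl ht.1
  have hanti : AntitoneOn (fun s => supportFn (F s) x) (timeInterval T) := by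
    have hd' : ∀ s ∈ interior (timeInterval T),
        HasDerivAt (fun s => supportFn (F s) x) (-f (gaussCurvature (F s) x)) s := fun s hs =>
      (hd s (interior_subset hs) x).hasDerivAt (mem_interior_iff_mem_nhds.1 hs)
    refine antitoneOn_of_deriv_nonpos (convex_timeInterval T)
      (fun s hs => (hd s hs x).continuousWithinAt)
      (fun s hs => (hd' s hs).differentiableAt.differentiableWithinAt) fun s hs => ?_
    rw [(hd' s hs).deriv]
    have hc := hF.strictlyConvex s (interior_subset hs)
    obtain ⟨w, μ, hw, hwx, -⟩ := exists_principal_frame hc hn x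
    have hK : 0 < gaussCurvature (F s) x := by
      rw [gaussCurvature_eq hc x hw hwx]
      exact one_div_pos.2 (posDef_secondForm hc x hw hwx).det_pos
    linarith [hf.pos _ hK]
  exact hanti h0 ht ht.1

/-- The solution stays in a ball whose radius is controlled by the initial support function. -/
theorem norm_flow_le (hn : 0 < n) (hf : SpeedCondition n f) {B : ℝ} (hB : 0 ≤ B)
    (h0 : ∀ x, supportFn (F 0) x ≤ B) {t : ℝ} (ht : t ∈ timeInterval T) (x : Sph n) :
    ‖F t x‖ ≤ 2 * B :=
  norm_le_of_supportFn_le (hF.strictlyConvex t ht) hn hB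
    (fun z => (supportFn_le_initial hF hn hf ht z).trans (h0 z)) x

theorem bddAbove_outerRadii (hn : 0 < n) (hf : SpeedCondition n f) :
    BddAbove (outerRadii T F) := by
  have h0 : (0 : ℝ) ∈ timeInterval T := ⟨le_rfl, by exact_mod_cast hF.time_pos⟩
  have hcont : Continuous (F 0) := (hF.strictlyConvex 0 h0).smooth.continuous
  obtain ⟨B, hB⟩ := (isCompact_univ.image hcont).isBounded.exists_norm_le
  have hB' : ∀ x, ‖F 0 x‖ ≤ B := fun x => hB _ ⟨x, Set.mem_univ _, rfl⟩
  have hB0 : 0 ≤ B := (norm_nonneg _).trans (hB' (basePoint n))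
  refine ⟨2 * B, ?_⟩
  rintro R ⟨t, ht, htT, rfl⟩
  refine outerRadius_le (by positivity) ?_
  rintro p ⟨x, rfl⟩
  refine norm_flow_le hF hn hf hB0 (fun z => ?_) ⟨ht.le, htT⟩ x
  refine (real_inner_le_norm _ _).trans ?_
  simpa using hB' z

theorem dist_initial_le (hn : 0 < n) (hf : SpeedCondition n f) (x y : Sph n) :
    ‖F 0 x - F 0 y‖ ≤ 2 * sSup (outerRadii T F) := by
  have hbdd := bddAbove_outerRadii hF hn hf
  have h0 : (0 : ℝ) ∈ timeInterval T := ⟨le_rfl, by exact_mod_cast hF.time_pos⟩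
  have hcontx : ∀ z : Sph n, ContinuousWithinAt (fun t => F t z) (timeInterval T) 0 := fun z => by
    have h := (contDiffOn_flow hF).continuousOn.comp
      (f := fun t : ℝ => (t, (z : Amb n))) (s := timeInterval T) (by fun_prop)
      fun t ht => ⟨ht, sph_ne_zero z⟩
    exact (h.congr fun t _ => (radialExt_coe (F t) z).symm) 0 h0
  obtain ⟨b, hb⟩ := openTime_nonempty hF.time_pos
  -- `outerRadii` contains positive times only, so the initial hypersurface is reached as a limit `t
  -- → 0`.
  have hlim : Tendsto (fun t => ‖F t x - F t y‖) (𝓝[openTime T] 0) (𝓝 ‖F 0 x - F 0 y‖) :=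
    (((hcontx x).sub (hcontx y)).norm).mono (openTime_subset T)
  have hne : (𝓝[openTime T] (0 : ℝ)).NeBot := by
    rw [← mem_closure_iff_nhdsWithin_neBot]
    have hsub : Set.Ioo 0 b ⊆ openTime T := fun s hs =>
      ⟨hs.1, (EReal.coe_lt_coe_iff.2 hs.2).trans hb.2⟩
    refine closure_mono hsub ?_
    rw [closure_Ioo hb.1.ne]
    exact ⟨le_rfl, hb.1.le⟩
  refine le_of_tendsto hlim ?_
  filter_upwards [self_mem_nhdsWithin] with t ht
  have hbd : Bornology.IsBounded (Set.range (F t)) := by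
    rw [← Set.image_univ]
    exact (isCompact_univ.image
      (hF.strictlyConvex t (openTime_subset T ht)).smooth.continuous).isBounded
  refine (dist_le_outerRadius hbd ⟨x, rfl⟩ ⟨y, rfl⟩).trans ?_
  have := le_csSup hbdd (show outerRadius (Set.range (F t)) ∈ outerRadii T F from
    ⟨t, ht.1, ht.2, rfl⟩)
  linarith

end Flow

/-! ### Constants of the initial hypersurface and conclusion -/

theorem exists_form_bound {F₀ : Sph n → Amb n} (hF₀ : IsStrictlyConvex F₀) :
    ∃ M : ℝ, 0 < M ∧
      ∀ x a : Sph n, ⟪fderiv ℝ (radialExt F₀) (x : Amb n) a, (a : Amb n)⟫ ≤ M := by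
  have h := (contDiffOn_radialExt hF₀.smooth).continuousOn_fderiv_of_isOpen isOpen_compl_zero
    (by simp)
  have h1 : Continuous fun q : Sph n × Sph n => fderiv ℝ (radialExt F₀) (q.1 : Amb n) :=
    h.comp_continuous (by fun_prop) fun q => sph_ne_zero q.1
  have h2 : Continuous fun q : Sph n × Sph n =>
      ⟪fderiv ℝ (radialExt F₀) (q.1 : Amb n) q.2, (q.2 : Amb n)⟫ :=
    (h1.clm_apply (by fun_prop)).inner (𝕜 := ℝ) (by fun_prop)
  obtain ⟨M, hM⟩ := (isCompact_univ.image h2).bddAbove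
  -- The maximum with `1` makes the bound positive at no cost, as the final constant must be.
  exact ⟨max M 1, lt_max_of_lt_right one_pos, fun x a =>
    (hM ⟨(x, a), Set.mem_univ _, rfl⟩).trans (le_max_left _ _)⟩

/-- A constant map has zero derivative, against the positive principal radii. -/
theorem exists_ne_of_isStrictlyConvex (hn : 0 < n) {F₀ : Sph n → Amb n}
    (hF₀ : IsStrictlyConvex F₀) : ∃ x y, F₀ x ≠ F₀ y := by
  by_contra! hconst
  obtain ⟨w, μ, hw, -, hD, hμ, -⟩ := exists_principal_frame hF₀ hn (basePoint n)
  have hfd : fderiv ℝ (radialExt F₀) (basePoint n : Amb n) = 0 := by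
    have : radialExt F₀ =ᶠ[𝓝 (basePoint n : Amb n)] fun _ => F₀ (basePoint n) := by
      filter_upwards [isOpen_compl_zero.mem_nhds (sph_ne_zero (basePoint n))] with y hy
      rw [radialExt_eq F₀ hy]
      exact hconst _ _
    rw [this.fderiv_eq]
    simp
  have h := hD ⟨0, hn⟩
  rw [hfd] at h
  exact smul_ne_zero (hμ _).ne' (hw.ne_zero _) h.symm

theorem radialExt_const_smul (F₀ : Sph n → Amb n) (ϑ : ℝ) :
    radialExt (fun x => ϑ • F₀ x) = ϑ • radialExt F₀ := by
  ext1 y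
  by_cases hy : y = 0
  · simp [radialExt, hy]
  · rw [Pi.smul_apply, radialExt_eq _ hy, radialExt_eq _ hy]

end GaussFlow

end

theorem lemma5p3 (n : ℕ) (hn : 2 ≤ n) (f : ℝ → ℝ) (hf : GaussFlow.SpeedCondition n f)
    (F₀ : GaussFlow.Sph n → GaussFlow.Amb n) (hF₀ : GaussFlow.IsStrictlyConvex F₀) :
    ∃ C : ℝ, 0 < C ∧
      ∀ (ϑ : ℝ), 0 < ϑ → ∀ (T : EReal) (F : ℝ → GaussFlow.Sph n → GaussFlow.Amb n),
        GaussFlow.IsFlow f ϑ F₀ T F →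
        BddAbove (GaussFlow.outerRadii T F) ∧
        ∀ t ∈ GaussFlow.timeInterval T, ∀ (x : GaussFlow.Sph n)
          (e : OrthonormalBasis (Fin n) ℝ (GaussFlow.Tan x)) (χ : ℝ),
          Module.End.HasEigenvalue
            (Matrix.toLin' (GaussFlow.radiiMatrix (GaussFlow.supportFn (F t)) x e)) χ →
          χ ≤ C * (1 + sSup (GaussFlow.outerRadii T F)) := by
  have hn0 : 0 < n := by omega
  obtain ⟨M, hM0, hM⟩ := GaussFlow.exists_form_bound hF₀
  obtain ⟨y, z, hyz⟩ := GaussFlow.exists_ne_of_isStrictlyConvex hn0 hF₀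
  have hd : 0 < ‖F₀ y - F₀ z‖ := norm_pos_iff.2 (sub_ne_zero.2 hyz)
  -- The radii are at most `ϑ * M`, and `ϑ * ‖F₀ y - F₀ z‖ ≤ 2 * R₀` eliminates `ϑ`.
  refine ⟨2 * M / ‖F₀ y - F₀ z‖, by positivity, fun ϑ hϑ T F hF =>
    ⟨GaussFlow.bddAbove_outerRadii hF hn0 hf, fun t ht x e χ hχ => ?_⟩⟩
  obtain ⟨a, rfl⟩ := GaussFlow.exists_eq_of_hasEigenvalue (hF.strictlyConvex t ht) x e hχ
  have hF0 : F 0 = fun x => ϑ • F₀ x := funext hF.initial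
  have hinit : ∀ x a : GaussFlow.Sph n,
      ⟪fderiv ℝ (GaussFlow.radialExt (F 0)) (x : GaussFlow.Amb n) a, (a : GaussFlow.Amb n)⟫ ≤
        ϑ * M := fun x a => by
    rw [hF0, GaussFlow.radialExt_const_smul, fderiv_const_smul
      (GaussFlow.hasFDerivAt_radialExt hF₀.smooth (GaussFlow.sph_ne_zero x)).differentiableAt]
    simp only [smul_apply, inner_smul_left, conj_trivial]
    exact mul_le_mul_of_nonneg_left (hM x a) hϑ.le
  have h1 := GaussFlow.form_le_of_initial hF hn0 hf hinit ht x a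
  have h2 := GaussFlow.dist_initial_le hF hn0 hf y z
  rw [hF.initial, hF.initial, ← smul_sub, norm_smul, Real.norm_of_nonneg hϑ.le] at h2
  refine h1.trans ?_
  rw [div_mul_eq_mul_div, le_div_iff₀ hd]
  nlinarith
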